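/- **Theorem (Subcritical $L^p$ Hardy inequalities on the sphere).** Let $n\ge 4$, let $\mathbb S^{n-1}$ be the unit sphere of $\mathbb R^n$ with surface measure $\sigma$, fix $\Phi\in\mathbb S^{n-1}$, and let $d(x)=\arccos(x\cdot\Phi)$ be the geodesic distance from $\Phi$. A function $u\in L^1(\mathbb S^{n-1})$ has weak surface gradient $\nabla u$ if $\nabla u$ is an integrable tangent vector field with $\int_{\mathbb S^{n-1}}\nabla u\cdot V\,d\sigma=-\int_{\mathbb S^{n-1}}u\,\operatorname{div}V\,d\sigma$ for every smooth tangent vector field $V$ on $\mathbb S^{n-1}$, and $W^{1,p}(\mathbb S^{n-1})$ is the space of real-valued $u\in L^p(\mathbb S^{n-1})$ that have a weak surface gradient with $|\nabla u|\in L^p(\mathbb S^{n-1})$. Put $\alpha=\frac{n-p-1}{p}$ and let $u\in W^{1,p}(\mathbb S^{n-1})$. (i) If $1<p<n-1$, then $\frac{u}{\sin d}\in L^p(\mathbb S^{n-1})$, all integrals below are finite, and $$\alpha^p\int_{\mathbb S^{n-1}}\frac{|u|^p}{\sin^p d}\,d\sigma\le\int_{\mathbb S^{n-1}}|\nabla u|^p|\cos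 d|^p\,d\sigma+(n-p)\,\alpha^{p-1}\int_{\mathbb S^{n-1}}\frac{|u|^p}{\sin^{p-2}d}\,d\sigma.$$ (ii) If $2\le p<n-1$, then $\frac{u}{|\tan d|}\in L^p(\mathbb S^{n-1})$, all integrals below are finite, and $$\alpha^p\int_{\mathbb S^{n-1}}\frac{|u|^p}{|\tan d|^p}\,d\sigma\le\int_{\mathbb S^{n-1}}|\nabla u|^p\,d\sigma+(p-1)\,\alpha^{p-1}\int_{\mathbb S^{n-1}}\frac{|u|^p}{|\tan d|^{p-2}}\,d\sigma.$$ -/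

import Mathlib

open MeasureTheory
open scoped ContDiff

noncomputable section

namespace SphereHardy

/-- Euclidean space `ℝⁿ`. -/
abbrev Space (n : ℕ) : Type := EuclideanSpace ℝ (Fin n)

/-- The unit sphere `S^{n-1}` in `ℝⁿ`. -/
abbrev Sphere (n : ℕ) : Type := Metric.sphere (0 : Space n) 1

/-- The surface measure `σ_{n-1}` on `S^{n-1}` (total mass `n * volume (ball 0 1)`). -/
abbrev surfaceMeasure (n : ℕ) : Measure (Sphere n) :=
  (volume : Measure (Space n)).toSphere

/-- The geodesic distance on `S^{n-1}`. -/
def geoDist {n : ℕ} (x y : Sphere n) : ℝ :=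
  Real.arccos (inner ℝ (x : Space n) (y : Space n))

/-- A smooth tangent vector field on `S^{n-1}`, given as the restriction to the sphere of a
smooth vector field of `ℝⁿ`. Every smooth tangent field of the sphere is such a restriction. -/
structure IsSmoothTangentField {n : ℕ} (V : Space n → Space n) : Prop where
  smooth : ContDiff ℝ ∞ V
  tangent : ∀ x : Sphere n, inner ℝ (V x) (x : Space n) = 0

/-- The surface divergence at `x ∈ S^{n-1}`: the trace of the derivative of `V` over the
tangent space `x^⊥`, i.e. the full trace minus the normal part. It depends only on the values
of `V` on the sphere. -/
def surfaceDiv {n : ℕ} (V : Space n → Space n) (x : Sphere n) : ℝ :=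
  (∑ i : Fin n, (fderiv ℝ V x (EuclideanSpace.single i 1)) i)
    - inner ℝ (fderiv ℝ V x (x : Space n)) (x : Space n)

/-- `Ψ` is a weak surface gradient of `u`: both are integrable, `Ψ` is tangent to the sphere,
and `∫ Ψ · V = - ∫ u div V` for all smooth tangent fields `V`. -/
structure IsWeakGradient {n : ℕ} (u : Sphere n → ℝ) (Ψ : Sphere n → Space n) : Prop where
  integrable_fun : Integrable u (surfaceMeasure n)
  integrable_grad : Integrable Ψ (surfaceMeasure n)
  tangent : ∀ᵐ x ∂(surfaceMeasure n), inner ℝ (Ψ x) (x : Space n) = 0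
  integral_eq : ∀ V : Space n → Space n, IsSmoothTangentField V →
    ∫ x, inner ℝ (Ψ x) (V x) ∂(surfaceMeasure n)
      = - ∫ x, u x * surfaceDiv V x ∂(surfaceMeasure n)

/-- `u` is weakly differentiable on `S^{n-1}`. -/
def WeaklyDifferentiable {n : ℕ} (u : Sphere n → ℝ) : Prop :=
  ∃ Ψ : Sphere n → Space n, IsWeakGradient u Ψ

open Classical in
/-- The weak surface gradient of `u` (unique up to null sets; `0` if there is none). -/
def weakGrad {n : ℕ} (u : Sphere n → ℝ) : Sphere n → Space n :=
  if h : WeaklyDifferentiable u then h.choose else 0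

/-- Membership in the Sobolev space `W^{1,p}(S^{n-1})`. -/
structure MemW1p {n : ℕ} (p : ℝ) (u : Sphere n → ℝ) : Prop where
  memLp : MemLp u (ENNReal.ofReal p) (surfaceMeasure n)
  weaklyDifferentiable : WeaklyDifferentiable u
  memLp_grad : MemLp (weakGrad u) (ENNReal.ofReal p) (surfaceMeasure n)

/-- The constant `α_{n,p} = (n - p - 1) / p`. -/
def alpha (n : ℕ) (p : ℝ) : ℝ := ((n : ℝ) - p - 1) / p

variable {n : ℕ}

/-- Integrand of `S_p`. -/
def sInt (Φ : Sphere n) (p : ℝ) (u : Sphere n → ℝ) (x : Sphere n) : ℝ :=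
  |u x| ^ p / Real.sin (geoDist x Φ) ^ p

/-- Integrand of `S̃_p`. -/
def sTildeInt (Φ : Sphere n) (p : ℝ) (u : Sphere n → ℝ) (x : Sphere n) : ℝ :=
  |u x| ^ p / Real.sin (geoDist x Φ) ^ (p - 2)

/-- Integrand of `T_p`. -/
def tInt (Φ : Sphere n) (p : ℝ) (u : Sphere n → ℝ) (x : Sphere n) : ℝ :=
  |u x| ^ p / |Real.tan (geoDist x Φ)| ^ p

/-- Integrand of `T̃_p`. -/
def tTildeInt (Φ : Sphere n) (p : ℝ) (u : Sphere n → ℝ) (x : Sphere n) : ℝ :=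
  |u x| ^ p / |Real.tan (geoDist x Φ)| ^ (p - 2)

/-- Integrand of `F_p`. -/
def fInt (p : ℝ) (u : Sphere n → ℝ) (x : Sphere n) : ℝ :=
  ‖weakGrad u x‖ ^ p

/-- Integrand of `G_p`. -/
def gInt (Φ : Sphere n) (p : ℝ) (u : Sphere n → ℝ) (x : Sphere n) : ℝ :=
  ‖weakGrad u x‖ ^ p * |Real.cos (geoDist x Φ)| ^ p

end SphereHardy

end

/-! Write s = x·Φ = cos d. The proof tests the weak gradient of |u|^p against a zonal field f(s)(Φ -
s x), whose surface divergence is f'(s)(1 - s²) - (n-1) s f(s).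

With w = (1 - s² + δ)^(-p/2), a regularization of sin^(-p) d, take f = -α^(p-1) k(s) w.
Differentiating w costs at most p s k, because s k ≥ 0, so the divergence is at least α^(p-1) w
((n-p-1) s k - k'(1 - s²)). On the other side, only the tangential part of Φ, of length √(1 - s²),
meets the gradient. If |k| ≤ A^(p-1) B, Young's inequality bounds that side by (p-1) α^p ∫ |u|^p A^p
w + ∫ |∇u|^p B^p. Since pα = n-p-1, the divergence supplies pα^p ∫ |u|^p A^p w up to a lower-order
term, and one copy of α^p survives. This is `hardy_regularized`. The profile k = s with A = 1, B =
|s| gives the sine inequality; k = |s|^(p-2) s with A = |s|, B = 1 gives the tangent one, where p ≥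
2 makes k of class C¹.

To let δ tend to 0 one needs |u|^p / sin^p d integrable. In the sine inequality the lower-order term
carries an extra factor sin² d: near the poles half of the left side absorbs it, and elsewhere the
weight is bounded. The resulting bound is uniform in δ, and Fatou gives `integrable_regWeight_zero`.
Dominated convergence then finishes both cases.

The remaining work is the chain rule for |u|^p, as weak gradients are defined only by duality with
smooth tangent fields. The 0-homogeneous extension of u to ℝⁿ has weak partial derivatives given by
the (-1)-homogeneous extension of the gradient (`IsWeakGradient.truncExt_identity`). The Euclidean
chain rule follows by mollification (`weak_chain_rule`) and returns to the sphere by testing with a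
radially cut-off extension of a tangent field (`IsWeakGradient.chain_rule`). Truncating the
derivative of |t|^p then reaches the power itself (`IsWeakGradient.abs_rpow`). -/

noncomputable section

namespace SphereHardy

open Filter Topology Set

/-! ### Mollification in L¹ and the Euclidean weak chain rule. -/

section Mollification

open Convolution ContinuousLinearMap

variable {E : Type*} [NormedAddCommGroup E] [InnerProductSpace ℝ E] [FiniteDimensional ℝ E]
  [MeasurableSpace E] [BorelSpace E] {μ : Measure E}

/-- Scheffé's lemma for nonnegative functions. -/
theorem tendsto_integral_abs_sub_of_nonneg {X : Type*} [MeasurableSpace X] {ν : Measure X}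
    {F : ℕ → X → ℝ} {f : X → ℝ} (hF : ∀ i, Integrable (F i) ν) (hf : Integrable f ν)
    (hF0 : ∀ i x, 0 ≤ F i x) (hf0 : ∀ x, 0 ≤ f x) (hI : ∀ i, ∫ x, F i x ∂ν = ∫ x, f x ∂ν)
    (hlim : ∀ᵐ x ∂ν, Tendsto (fun i => F i x) atTop (𝓝 (f x))) :
    Tendsto (fun i => ∫ x, |F i x - f x| ∂ν) atTop (𝓝 0) := by
  -- Equal integrals make the positive and negative parts of f - F contribute equally; the positive
  -- part is dominated by f.
  have key : ∀ i, ∫ x, |F i x - f x| ∂ν = 2 * ∫ x, max (f x - F i x) 0 ∂ν := by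
    intro i
    have h1 : ∀ x, |F i x - f x| = (F i x - f x) + 2 * max (f x - F i x) 0 := by
      intro x
      rcases le_total (F i x) (f x) with h | h
      · rw [abs_of_nonpos (by linarith), max_eq_left (by linarith)]; ring
      · rw [abs_of_nonneg (by linarith), max_eq_right (by linarith)]; ring
    simp_rw [h1]
    have h2 : Integrable (fun x => 2 * max (f x - F i x) 0) ν :=
      ((hf.sub (hF i)).pos_part).const_mul 2
    have h3 : Integrable (fun x => F i x - f x) ν := (hF i).sub hf
    rw [integral_add h3 h2, integral_sub (hF i) hf, hI i, integral_const_mul]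
    ring
  simp_rw [key]
  have : Tendsto (fun i => ∫ x, max (f x - F i x) 0 ∂ν) atTop (𝓝 (∫ _, (0 : ℝ) ∂ν)) := by
    refine tendsto_integral_of_dominated_convergence f
      (fun i => ((hf.sub (hF i)).pos_part).aestronglyMeasurable) hf (fun i => ?_) ?_
    · refine Eventually.of_forall fun x => ?_
      rw [Real.norm_of_nonneg (le_max_right _ _)]
      exact max_le (by linarith [hF0 i x]) (hf0 x)
    · filter_upwards [hlim] with x hx
      have h2 : Tendsto (fun i => max (f x - F i x) 0) atTop (𝓝 (max (f x - f x) 0)) :=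
        (tendsto_const_nhds.sub hx).max tendsto_const_nhds
      simpa using h2
  simpa using this.const_mul 2

variable [μ.IsAddHaarMeasure]

/-- Mollifying a nonnegative function preserves its integral and converges almost everywhere by
Lebesgue differentiation, so Scheffé's lemma applies. The general case splits into positive and
negative parts. -/
theorem tendsto_integral_abs_mollify_sub {φ : ℕ → ContDiffBump (0 : E)} {K : ℝ}
    (hφ : Tendsto (fun i => (φ i).rOut) atTop (𝓝 0)) (hK : ∀ i, (φ i).rOut ≤ K * (φ i).rIn)
    {f : E → ℝ} (hf : Integrable f μ) :
    Tendsto (fun i => ∫ x, |((φ i).normed μ ⋆[lsmul ℝ ℝ, μ] f) x - f x| ∂μ) atTop (𝓝 0) := by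
  have hpos : ∀ g : E → ℝ, Integrable g μ → (∀ x, 0 ≤ g x) →
      Tendsto (fun i => ∫ x, |((φ i).normed μ ⋆[lsmul ℝ ℝ, μ] g) x - g x| ∂μ) atTop (𝓝 0) := by
    intro g hg hg0
    refine tendsto_integral_abs_sub_of_nonneg
      (fun i => (φ i).integrable_normed.integrable_convolution _ hg) hg (fun i x => ?_) hg0
      (fun i => ?_) ?_
    · exact integral_nonneg fun t => mul_nonneg ((φ i).nonneg_normed t) (hg0 _)
    · rw [integral_convolution _ (φ i).integrable_normed hg, (φ i).integral_normed]
      simp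
    · exact ContDiffBump.ae_convolution_tendsto_right_of_locallyIntegrable hφ
        (Eventually.of_forall hK) hg.locallyIntegrable
  have h1 := hpos _ hf.pos_part (fun x => le_max_right _ _)
  have h2 := hpos _ hf.neg_part (fun x => le_max_right _ _)
  have hsum := h1.add h2
  rw [add_zero] at hsum
  refine squeeze_zero (fun i => integral_nonneg fun x => abs_nonneg _) (fun i => ?_) hsum
  have i1 := ((φ i).integrable_normed.integrable_convolution (lsmul ℝ ℝ) hf.pos_part (μ := μ)).sub
    hf.pos_part
  have i2 := ((φ i).integrable_normed.integrable_convolution (lsmul ℝ ℝ) hf.neg_part (μ := μ)).sub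
    hf.neg_part
  have i0 := ((φ i).integrable_normed.integrable_convolution (lsmul ℝ ℝ) hf (μ := μ)).sub hf
  refine le_of_le_of_eq ?_ (integral_add i1.abs i2.abs)
  refine integral_mono i0.abs (i1.abs.add i2.abs) fun x => ?_
  have hex : ∀ g : E → ℝ, Integrable g μ →
      Integrable (fun t => (φ i).normed μ t * g (x - t)) μ := fun g hg =>
    (φ i).hasCompactSupport_normed.convolutionExists_left (lsmul ℝ ℝ)
      (φ i).continuous_normed hg.locallyIntegrable x
  have hlin : ((φ i).normed μ ⋆[lsmul ℝ ℝ, μ] f) x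
      = ((φ i).normed μ ⋆[lsmul ℝ ℝ, μ] fun x => max (f x) 0) x
        - ((φ i).normed μ ⋆[lsmul ℝ ℝ, μ] fun x => max (-f x) 0) x := by
    simp only [convolution_def, lsmul_apply, smul_eq_mul]
    rw [← integral_sub (hex _ hf.pos_part) (hex _ hf.neg_part)]
    refine integral_congr_ae (Eventually.of_forall fun t => ?_)
    simp only
    rw [← mul_sub, max_zero_sub_eq_self]
  have hx : f x = max (f x) 0 - max (-f x) 0 := (max_zero_sub_eq_self _).symm
  beta_reduce
  rw [hlin]
  calc _ = |(((φ i).normed μ ⋆[lsmul ℝ ℝ, μ] fun x => max (f x) 0) x - max (f x) 0)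
        - (((φ i).normed μ ⋆[lsmul ℝ ℝ, μ] fun x => max (-f x) 0) x - max (-f x) 0)| := by
        congr 1; linarith
    _ ≤ _ := abs_sub _ _

/-- The derivative falls on the kernel, and t ↦ φ(x - t) is itself an admissible test function. Its
support lies within distance 1 of x, which is why the weak identity is assumed on the ball of radius
R + 1. -/
theorem fderiv_mollify_apply {U G : E → ℝ} {e : E} {R : ℝ} (hU : Integrable U μ)
    (hw : ∀ ψ : E → ℝ, ContDiff ℝ ∞ ψ → HasCompactSupport ψ →
      Function.support ψ ⊆ Metric.ball 0 (R + 1) →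
      ∫ x, ψ x * G x ∂μ = - ∫ x, U x * fderiv ℝ ψ x e ∂μ)
    (φ : ContDiffBump (0 : E)) (hφ : φ.rOut ≤ 1) {x : E} (hx : x ∈ Metric.ball (0 : E) R) :
    fderiv ℝ (φ.normed μ ⋆[lsmul ℝ ℝ, μ] U) x e = (φ.normed μ ⋆[lsmul ℝ ℝ, μ] G) x := by
  have hsm : ContDiff ℝ ∞ (φ.normed μ) := φ.contDiff_normed
  have hd := φ.hasCompactSupport_normed.hasFDerivAt_convolution_left (lsmul ℝ ℝ)
    (hsm.of_le (by norm_cast)) hU.locallyIntegrable x (μ := μ) (𝕜 := ℝ)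
  rw [hd.fderiv]
  have hex : Integrable (fun t => ((lsmul ℝ ℝ).precompL E (fderiv ℝ (φ.normed μ) t)) (U (x - t)))
      μ := (φ.hasCompactSupport_normed.fderiv ℝ).convolutionExists_left _
      (hsm.continuous_fderiv (by simp)) hU.locallyIntegrable x
  rw [convolution_def, ContinuousLinearMap.integral_apply hex, convolution_eq_swap,
    ← integral_sub_left_eq_self _ μ x]
  set ψ : E → ℝ := fun t => φ.normed μ (x - t) with hψ
  have hψs : ContDiff ℝ ∞ ψ := hsm.comp (contDiff_const.sub contDiff_id)
  have hψd : ∀ t, fderiv ℝ ψ t e = - fderiv ℝ (φ.normed μ) (x - t) e := by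
    intro t
    have h1 : HasFDerivAt (fun t : E => x - t) (-ContinuousLinearMap.id ℝ E) t :=
      (hasFDerivAt_id t).const_sub x
    have h2 := ((hsm.differentiable (by simp) (x - t)).hasFDerivAt).comp t h1
    have h3 : fderiv ℝ ψ t = _ := h2.fderiv
    rw [h3]; simp
  have hsupp : Function.support ψ ⊆ Metric.closedBall x 1 := by
    intro t ht
    have : x - t ∈ Function.support (φ.normed μ) := ht
    rw [φ.support_normed_eq, mem_ball_zero_iff] at this
    rw [mem_closedBall_iff_norm']
    linarith
  have hcs : HasCompactSupport ψ :=
    HasCompactSupport.of_support_subset_isCompact (isCompact_closedBall x 1) hsupp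
  have hb : Function.support ψ ⊆ Metric.ball 0 (R + 1) := by
    intro t ht
    have h1 := hsupp ht
    rw [mem_closedBall_iff_norm'] at h1
    rw [mem_ball_zero_iff] at hx ⊢
    calc ‖t‖ = ‖x - (x - t)‖ := by congr 1; abel
      _ ≤ ‖x‖ + ‖x - t‖ := norm_sub_le _ _
      _ < R + 1 := by linarith
  have := hw ψ hψs hcs hb
  simp only [lsmul_apply, smul_eq_mul]
  rw [show (∫ t, φ.normed μ (x - t) * G t ∂μ) = ∫ t, ψ t * G t ∂μ from rfl, this, ← integral_neg]
  refine integral_congr_ae (Eventually.of_forall fun t => ?_)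
  simp only [hψd, sub_sub_cancel]
  simp [ContinuousLinearMap.precompL]
  ring

/-- The chain rule for weak directional derivatives. -/
theorem weak_chain_rule {U G : E → ℝ} {e : E} {R : ℝ} (hU : Integrable U μ)
    (hG : Integrable G μ)
    (hw : ∀ ψ : E → ℝ, ContDiff ℝ ∞ ψ → HasCompactSupport ψ →
      Function.support ψ ⊆ Metric.ball 0 (R + 1) →
      ∫ x, ψ x * G x ∂μ = - ∫ x, U x * fderiv ℝ ψ x e ∂μ)
    {β : ℝ → ℝ} (hβ : ContDiff ℝ 1 β) {M : ℝ} (hM : ∀ t, |deriv β t| ≤ M)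
    {φ : E → ℝ} (hφ : ContDiff ℝ 1 φ) (hφc : HasCompactSupport φ)
    (hφR : Function.support φ ⊆ Metric.ball 0 R) :
    ∫ x, φ x * (deriv β (U x) * G x) ∂μ = - ∫ x, β (U x) * fderiv ℝ φ x e ∂μ := by
  have hM0 : 0 ≤ M := (abs_nonneg _).trans (hM 0)
  have hLip : ∀ s t, |β s - β t| ≤ M * |s - t| := by
    intro s t
    simpa [Real.norm_eq_abs] using Convex.norm_image_sub_le_of_norm_deriv_le (𝕜 := ℝ) (f := β)
      (s := Set.univ) (fun x _ => hβ.differentiable (by simp) x) (fun x _ => hM x) convex_univ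
      (Set.mem_univ t) (Set.mem_univ s)
  have hβc : Continuous (deriv β) := hβ.continuous_deriv (by simp)
  -- The fixed ratio 2 of outer to inner radius is what Lebesgue differentiation needs; outer radii
  -- at most 1 keep the kernels inside the margin between R and R + 1.
  let ρ : ℕ → ContDiffBump (0 : E) := fun i =>
    ⟨1 / (2 * ((i : ℝ) + 1)), 1 / ((i : ℝ) + 1), by positivity, by
      apply one_div_lt_one_div_of_lt (by positivity); linarith [(Nat.cast_nonneg i : (0:ℝ) ≤ i)]⟩
  have hρ : Tendsto (fun i => (ρ i).rOut) atTop (𝓝 0) := tendsto_one_div_add_atTop_nhds_zero_nat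
  have hρK : ∀ i, (ρ i).rOut ≤ 2 * (ρ i).rIn := fun i => by
    change 1 / ((i : ℝ) + 1) ≤ 2 * (1 / (2 * ((i : ℝ) + 1)))
    apply le_of_eq; field_simp
  have hρ1 : ∀ i, (ρ i).rOut ≤ 1 := fun i => by
    change 1 / ((i : ℝ) + 1) ≤ 1
    rw [div_le_one (by positivity)]; linarith [(Nat.cast_nonneg i : (0:ℝ) ≤ i)]
  let V : ℕ → E → ℝ := fun i => (ρ i).normed μ ⋆[lsmul ℝ ℝ, μ] U
  let H : ℕ → E → ℝ := fun i => (ρ i).normed μ ⋆[lsmul ℝ ℝ, μ] G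
  have hV1 := tendsto_integral_abs_mollify_sub hρ hρK hU
  have hH1 := tendsto_integral_abs_mollify_sub hρ hρK hG
  have hVint : ∀ i, Integrable (V i) μ := fun i =>
    (ρ i).integrable_normed.integrable_convolution _ hU
  have hHint : ∀ i, Integrable (H i) μ := fun i =>
    (ρ i).integrable_normed.integrable_convolution _ hG
  have hVae : ∀ᵐ x ∂μ, Tendsto (fun i => V i x) atTop (𝓝 (U x)) :=
    ContDiffBump.ae_convolution_tendsto_right_of_locallyIntegrable hρ
        (Eventually.of_forall hρK) hU.locallyIntegrable
  have hVs : ∀ i, ContDiff ℝ 1 (V i) := fun i =>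
    (ρ i).hasCompactSupport_normed.contDiff_convolution_left (n := 1) (lsmul ℝ ℝ)
      ((ρ i).contDiff_normed) hU.locallyIntegrable
  have hφcont : Continuous φ := hφ.continuous
  have hdφ : Continuous (fun x => fderiv ℝ φ x e) :=
    (hφ.continuous_fderiv (by simp)).clm_apply continuous_const
  have hdφc : HasCompactSupport (fun x => fderiv ℝ φ x e) := hφc.fderiv_apply ℝ e
  obtain ⟨C, hC⟩ := hφc.exists_bound_of_continuous hφcont
  obtain ⟨D, hD⟩ := hdφc.exists_bound_of_continuous hdφ
  have hC0 : 0 ≤ C := (norm_nonneg _).trans (hC 0)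
  have hD0 : 0 ≤ D := (norm_nonneg _).trans (hD 0)
  have hibp : ∀ i, ∫ x, φ x * (deriv β (V i x) * H i x) ∂μ
      = - ∫ x, β (V i x) * fderiv ℝ φ x e ∂μ := by
    intro i
    have hc : ContDiff ℝ 1 (fun x => β (V i x)) := hβ.comp (hVs i)
    have hcf : Continuous fun x => fderiv ℝ (fun x => β (V i x)) x e :=
      (hc.continuous_fderiv (by simp)).clm_apply continuous_const
    rw [integral_mul_fderiv_eq_neg_fderiv_mul_of_integrable (f := fun x => β (V i x)) (g := φ)
      ((hcf.mul hφcont).integrable_of_hasCompactSupport hφc.mul_left)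
      ((hc.continuous.mul hdφ).integrable_of_hasCompactSupport hdφc.mul_left)
      ((hc.continuous.mul hφcont).integrable_of_hasCompactSupport hφc.mul_left)
      (fun x _ => hc.differentiable (by simp) x) (fun x _ => hφ.differentiable (by simp) x),
      neg_neg]
    refine integral_congr_ae (Eventually.of_forall fun x => ?_)
    simp only
    -- The mollification of U is known to have derivative the mollification of G only on the ball of
    -- radius R; off the support of φ both integrands vanish.
    by_cases hx : x ∈ Function.support φ
    · have hfd : fderiv ℝ (fun x => β (V i x)) x e = deriv β (V i x) * H i x := by
        have h1 := ((hβ.differentiable (by simp) (V i x)).hasDerivAt).comp_hasFDerivAt x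
          (((hVs i).differentiable (by simp) x).hasFDerivAt)
        have h2 : fderiv ℝ (fun x => β (V i x)) x = _ := h1.fderiv
        rw [h2]
        have h3 := fderiv_mollify_apply hU hw (ρ i) (hρ1 i) (hφR hx)
        exact congrArg (deriv β (V i x) * ·) h3
      rw [hfd]; ring
    · rw [Function.notMem_support.mp hx]; ring
  have hmeasβ : ∀ {f : E → ℝ}, AEStronglyMeasurable f μ →
      AEStronglyMeasurable (fun x => deriv β (f x)) μ := fun hf =>
    hβc.comp_aestronglyMeasurable hf
  have hβint : ∀ {f : E → ℝ}, Integrable f μ →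
      Integrable (fun x => β (f x) * fderiv ℝ φ x e) μ := by
    intro f hf
    have h1 : Integrable (fun x => β 0 * fderiv ℝ φ x e) μ :=
      (hdφ.integrable_of_hasCompactSupport hdφc).const_mul _
    have h2 : Integrable (fun x => (β (f x) - β 0) * fderiv ℝ φ x e) μ := by
      refine (hf.abs.const_mul (M * D)).mono'
        (((hβ.continuous.comp_aestronglyMeasurable hf.1).sub aestronglyMeasurable_const).mul
          hdφ.aestronglyMeasurable) (Eventually.of_forall fun x => ?_)
      rw [norm_mul, Real.norm_eq_abs]
      calc _ ≤ (M * |f x - 0|) * D :=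
            mul_le_mul (hLip _ _) (hD x) (norm_nonneg _) (by positivity)
        _ = _ := by simp only [sub_zero]; ring
    refine (h1.add h2).congr (Eventually.of_forall fun x => ?_)
    simp only [Pi.add_apply]; ring
  have lim1 : Tendsto (fun i => ∫ x, β (V i x) * fderiv ℝ φ x e ∂μ) atTop
      (𝓝 (∫ x, β (U x) * fderiv ℝ φ x e ∂μ)) := by
    rw [tendsto_iff_norm_sub_tendsto_zero]
    have hl := hV1.const_mul (M * D)
    rw [mul_zero] at hl
    refine squeeze_zero (fun _ => norm_nonneg _) (fun i => ?_) hl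
    rw [← integral_sub (hβint (hVint i)) (hβint hU), ← integral_const_mul]
    refine norm_integral_le_of_norm_le (((hVint i).sub hU).abs.const_mul _)
      (Eventually.of_forall fun x => ?_)
    rw [← sub_mul, norm_mul, Real.norm_eq_abs]
    calc _ ≤ (M * |V i x - U x|) * D :=
          mul_le_mul (hLip _ _) (hD x) (norm_nonneg _) (by positivity)
      _ = _ := by simp only [V]; ring
  have hprod : ∀ {f g : E → ℝ}, AEStronglyMeasurable f μ → Integrable g μ →
      Integrable (fun x => φ x * (deriv β (f x) * g x)) μ := by
    intro f g hf hg
    refine (hg.abs.const_mul (C * M)).mono'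
      (hφcont.aestronglyMeasurable.mul ((hmeasβ hf).mul hg.1)) (Eventually.of_forall fun x => ?_)
    rw [norm_mul, norm_mul, mul_assoc]
    exact mul_le_mul (hC x) (mul_le_mul_of_nonneg_right (hM _) (abs_nonneg _))
      (by positivity) hC0
  have lim2 : Tendsto (fun i => ∫ x, φ x * (deriv β (V i x) * H i x) ∂μ) atTop
      (𝓝 (∫ x, φ x * (deriv β (U x) * G x) ∂μ)) := by
    -- No common dominating function is at hand for the H i, so H i is split as G + (H i - G):
    -- dominated convergence handles the first part, L¹ convergence and boundedness of β' the
    -- second.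
    have hA : Tendsto (fun i => ∫ x, φ x * (deriv β (V i x) * G x) ∂μ) atTop
        (𝓝 (∫ x, φ x * (deriv β (U x) * G x) ∂μ)) := by
      refine tendsto_integral_of_dominated_convergence (fun x => C * M * |G x|)
        (fun i => (hprod (hVint i).1 hG).1) (hG.abs.const_mul _)
        (fun i => Eventually.of_forall fun x => ?_) ?_
      · rw [norm_mul, norm_mul, mul_assoc]
        exact mul_le_mul (hC x) (mul_le_mul_of_nonneg_right (hM _) (abs_nonneg _))
          (by positivity) hC0
      · filter_upwards [hVae] with x hx
        exact (((hβc.tendsto _).comp hx).mul_const _).const_mul _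
    have hB : Tendsto (fun i => ∫ x, φ x * (deriv β (V i x) * (H i x - G x)) ∂μ) atTop
        (𝓝 0) := by
      have hl := hH1.const_mul (C * M)
      rw [mul_zero] at hl
      refine squeeze_zero_norm (fun i => ?_) hl
      rw [← integral_const_mul]
      refine norm_integral_le_of_norm_le (((hHint i).sub hG).abs.const_mul _)
        (Eventually.of_forall fun x => ?_)
      rw [norm_mul, norm_mul, mul_assoc]
      exact mul_le_mul (hC x) (mul_le_mul_of_nonneg_right (hM _) (abs_nonneg _))
        (by positivity) hC0
    have hsum := hA.add hB
    rw [add_zero] at hsum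
    refine hsum.congr fun i => ?_
    refine (integral_add (hprod (hVint i).1 hG)
      (hprod (hVint i).1 ((hHint i).sub hG))).symm.trans ?_
    refine integral_congr_ae (Eventually.of_forall fun x => ?_)
    simp only [Pi.sub_apply]; ring
  exact tendsto_nhds_unique lim2 (lim1.neg.congr fun i => (hibp i).symm)

end Mollification

variable {n : ℕ}

/-! ### Polar coordinates on ℝⁿ. -/

section Polar

/-- The product of the surface measure and Lebesgue measure on `(0, ∞)`. -/
abbrev polarMeasure (n : ℕ) : Measure (Sphere n × ℝ) :=
  (surfaceMeasure n).prod (volume.restrict (Ioi 0))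

theorem nontrivial_space (hn : 2 ≤ n) : Nontrivial (Space n) := by
  have : Nonempty (Fin n) := ⟨⟨0, by omega⟩⟩
  infer_instance

theorem measurePreserving_polar (hn : 2 ≤ n) :
    MeasurePreserving (fun z : Sphere n × Ioi (0 : ℝ) => (z.2 : ℝ) • (z.1 : Space n))
      ((surfaceMeasure n).prod (Measure.volumeIoiPow (n - 1))) volume := by
  have := nontrivial_space hn
  have h1 := (volume : Measure (Space n)).measurePreserving_homeomorphUnitSphereProd
  rw [finrank_euclideanSpace_fin] at h1
  have h2 := MeasurePreserving.symm (homeomorphUnitSphereProd (Space n)).toMeasurableEquiv h1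
  have h3 := measurePreserving_subtype_coe (μa := (volume : Measure (Space n)))
    (measurableSet_singleton (0 : Space n)).compl
  rw [restrict_compl_singleton] at h3
  exact h3.comp h2

theorem measurableEmbedding_polar :
    MeasurableEmbedding (fun z : Sphere n × Ioi (0 : ℝ) => (z.2 : ℝ) • (z.1 : Space n)) :=
  (MeasurableEmbedding.subtype_coe (measurableSet_singleton (0 : Space n)).compl).comp
    (homeomorphUnitSphereProd (Space n)).symm.measurableEmbedding

instance sFinite_comap_Ioi : SFinite (Measure.comap Subtype.val volume : Measure (Ioi (0 : ℝ))) := by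
  have : SigmaFinite (Measure.comap Subtype.val volume : Measure (Ioi (0 : ℝ))) := by
    refine SigmaFinite.of_map _ measurable_subtype_coe.aemeasurable ?_
    rw [(measurePreserving_subtype_coe measurableSet_Ioi).map_eq]
    infer_instance
  infer_instance

theorem measurePreserving_subtype_polar :
    MeasurePreserving (Prod.map id Subtype.val : Sphere n × Ioi (0 : ℝ) → Sphere n × ℝ)
      ((surfaceMeasure n).prod (.comap Subtype.val volume)) (polarMeasure n) :=
  (MeasurePreserving.id _).prod (measurePreserving_subtype_coe measurableSet_Ioi)

theorem prod_volumeIoiPow (n m : ℕ) :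
    (surfaceMeasure n).prod (Measure.volumeIoiPow m)
      = ((surfaceMeasure n).prod (.comap Subtype.val volume)).withDensity
          fun z : Sphere n × Ioi (0 : ℝ) => ((Real.toNNReal (z.2.1 ^ m) : NNReal) : ENNReal) := by
  have : SigmaFinite ((Measure.comap Subtype.val volume : Measure (Ioi (0 : ℝ))).withDensity
      fun r => ENNReal.ofReal (r.1 ^ m)) :=
    inferInstanceAs (SigmaFinite (Measure.volumeIoiPow m))
  rw [Measure.volumeIoiPow, prod_withDensity_right]
  · rfl
  · fun_prop

theorem integrable_iff_polar (hn : 2 ≤ n) (f : Space n → ℝ) :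
    Integrable f ↔ Integrable
      (fun z : Sphere n × ℝ => z.2 ^ (n - 1) * f (z.2 • (z.1 : Space n))) (polarMeasure n) := by
  rw [← (measurePreserving_polar hn).integrable_comp_emb measurableEmbedding_polar,
    prod_volumeIoiPow, integrable_withDensity_iff_integrable_smul (by fun_prop),
    ← measurePreserving_subtype_polar.integrable_comp_emb
      (MeasurableEmbedding.id.prodMap (MeasurableEmbedding.subtype_coe measurableSet_Ioi))]
  refine integrable_congr (Eventually.of_forall fun z => ?_)
  have : (0 : ℝ) ≤ z.2.1 ^ (n - 1) := pow_nonneg z.2.2.le _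
  simp [NNReal.smul_def, Real.coe_toNNReal _ this]

theorem integral_polar (hn : 2 ≤ n) (f : Space n → ℝ) :
    ∫ x, f x = ∫ z : Sphere n × ℝ, z.2 ^ (n - 1) * f (z.2 • (z.1 : Space n))
      ∂(polarMeasure n) := by
  rw [← (measurePreserving_polar hn).integral_comp measurableEmbedding_polar,
    prod_volumeIoiPow, integral_withDensity_eq_integral_smul (by fun_prop),
    ← measurePreserving_subtype_polar.integral_comp
      (MeasurableEmbedding.id.prodMap (MeasurableEmbedding.subtype_coe measurableSet_Ioi))]
  refine integral_congr_ae (Eventually.of_forall fun z => ?_)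
  have : (0 : ℝ) ≤ z.2.1 ^ (n - 1) := pow_nonneg z.2.2.le _
  simp [NNReal.smul_def, Real.coe_toNNReal _ this]

theorem ae_polar_pos : ∀ᵐ z ∂(polarMeasure n), 0 < z.2 := by
  have : ∀ᵐ r ∂(volume.restrict (Ioi (0 : ℝ))), 0 < r := ae_restrict_mem measurableSet_Ioi
  exact Measure.quasiMeasurePreserving_snd.ae this

theorem integrable_mul_continuous_polar {u : Sphere n → ℝ} (hu : Integrable u (surfaceMeasure n))
    {K : Sphere n × ℝ → ℝ} (hK : Continuous K) {R : ℝ} (hR : ∀ z, R < z.2 → K z = 0) :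
    Integrable (fun z => u z.1 * K z) (polarMeasure n) := by
  obtain ⟨C, hC⟩ := (isCompact_univ (X := Sphere n)).prod (isCompact_Icc (a := (0 : ℝ)) (b := R))
    |>.exists_bound_of_continuousOn hK.continuousOn
  have h1 : Integrable ((Icc (0 : ℝ) R).indicator fun _ => (1 : ℝ)) (volume.restrict (Ioi 0)) :=
    ((integrable_indicator_iff measurableSet_Icc).2
      (integrableOn_const (by simp))).restrict
  have h2 := (hu.mul_prod h1).bdd_mul (f := fun z => (Icc (0 : ℝ) R).indicator (fun _ => K z) z.2)
    (c := max C 0) ?_ ?_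
  · refine h2.congr ?_
    filter_upwards [ae_polar_pos] with z hz
    by_cases h : z.2 ≤ R
    · have : z.2 ∈ Icc (0 : ℝ) R := ⟨hz.le, h⟩
      simp [this, mul_comm]
    · simp [hR z (not_le.1 h)]
  · have : (fun z : Sphere n × ℝ => (Icc (0 : ℝ) R).indicator (fun _ => K z) z.2)
        = (Prod.snd ⁻¹' Icc (0 : ℝ) R).indicator K := by
      ext z; simp [indicator]
    rw [this]
    exact (hK.measurable.indicator (measurable_snd measurableSet_Icc)).aestronglyMeasurable
  · refine Eventually.of_forall fun z => ?_
    by_cases h : z.2 ∈ Icc (0 : ℝ) R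
    · simp only [h, indicator_of_mem]
      exact (hC z ⟨mem_univ _, h⟩).trans (le_max_left _ _)
    · simp [h]

end Polar

/-! ### Surface divergence of projected fields. -/

section SurfaceDivergence

theorem norm_coe_sphere (x : Sphere n) : ‖(x : Space n)‖ = 1 := by simp

theorem inner_coe_self (x : Sphere n) : inner ℝ (x : Space n) (x : Space n) = 1 := by simp

theorem sum_clm_apply_mul (L : Space n →L[ℝ] ℝ) (w : Space n) :
    ∑ i, L (EuclideanSpace.single i 1) * w i = L w := by
  conv_rhs => rw [← (EuclideanSpace.basisFun (Fin n) ℝ).sum_repr w, map_sum]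
  simp [mul_comm]

theorem surfaceDiv_of_hasFDerivAt {V : Space n → Space n} {L : Space n →L[ℝ] Space n}
    {x : Sphere n} (h : HasFDerivAt V L x) :
    surfaceDiv V x = (∑ i, (L (EuclideanSpace.single i 1)) i)
      - inner ℝ (L (x : Space n)) (x : Space n) := by
  rw [surfaceDiv, h.fderiv]

theorem hasFDerivAt_inner_left (e x : Space n) :
    HasFDerivAt (fun y : Space n => inner ℝ y e) (innerSL ℝ e) x := by
  have := (innerSL ℝ e).hasFDerivAt (x := x)
  refine this.congr_of_eventuallyEq (Eventually.of_forall fun y => ?_)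
  simp [real_inner_comm]

/-- The divergence of the tangential projection of `g • e`. -/
theorem surfaceDiv_smul_tangent {g : Space n → ℝ} {g' : Space n →L[ℝ] ℝ} {x : Sphere n}
    (hg : HasFDerivAt g g' x) (e : Space n) :
    surfaceDiv (fun y => g y • (e - inner ℝ y e • y)) x
      = g' (e - inner ℝ (x : Space n) e • (x : Space n))
        - ((n : ℝ) - 1) * (g x * inner ℝ (x : Space n) e) := by
  have h1 : HasFDerivAt (fun y : Space n => e - inner ℝ y e • y) _ (x : Space n) :=
    ((hasFDerivAt_inner_left e x).smul (hasFDerivAt_id (x : Space n))).const_sub e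
  refine (surfaceDiv_of_hasFDerivAt (hg.smul h1)).trans ?_
  set w : Space n := e - inner ℝ (x : Space n) e • (x : Space n) with hw
  have hwx : inner ℝ w (x : Space n) = 0 := by
    rw [hw, inner_sub_left, inner_smul_left, inner_coe_self, real_inner_comm]; simp
  have h2 : ∑ i, g' (EuclideanSpace.single i 1) * w i = g' w := sum_clm_apply_mul g' w
  have h3 : ∑ i, inner ℝ e (EuclideanSpace.single i (1 : ℝ)) * (x : Space n) i
      = inner ℝ e (x : Space n) := by
    simpa using sum_clm_apply_mul (innerSL ℝ e) (x : Space n)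
  have h4 : ∑ i : Fin n, (EuclideanSpace.single i (1 : ℝ) : Space n) i = (n : ℝ) := by simp
  have hxe : inner ℝ (x : Space n) e = inner ℝ e (x : Space n) := real_inner_comm _ _
  simp only [id_eq, add_apply, smul_apply, neg_apply,
    ContinuousLinearMap.smulRight_apply, ContinuousLinearMap.id_apply, innerSL_apply_apply,
    PiLp.add_apply, PiLp.smul_apply, PiLp.neg_apply, smul_eq_mul, inner_add_left,
    inner_smul_left, inner_neg_left, RCLike.conj_to_real, hwx, inner_coe_self, hxe] at *
  rw [Finset.sum_add_distrib, h2, ← Finset.mul_sum]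
  simp only [Finset.sum_neg_distrib, Finset.sum_add_distrib, ← Finset.mul_sum, h3, h4]
  ring

end SurfaceDivergence

/-! ### Homogeneous extensions and their weak derivatives. -/

section RadialExtension

/-- The extension of a function on the sphere that is homogeneous of degree `-m`,
cut off outside the closed ball of radius `R`. -/
def truncExt (m : ℕ) (R : ℝ) (f : Sphere n → ℝ) (x : Space n) : ℝ :=
  if h : x ≠ 0 ∧ ‖x‖ ≤ R then
    (‖x‖ ^ m)⁻¹ * f ⟨‖x‖⁻¹ • x, by
      have := norm_ne_zero_iff.2 h.1
      simp [norm_smul, this]⟩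
  else 0

theorem norm_smul_coe_sphere {r : ℝ} (hr : 0 < r) (θ : Sphere n) : ‖r • (θ : Space n)‖ = r := by
  rw [norm_smul, norm_coe_sphere, mul_one, Real.norm_of_nonneg hr.le]

theorem smul_coe_sphere_ne_zero {r : ℝ} (hr : 0 < r) (θ : Sphere n) : r • (θ : Space n) ≠ 0 := by
  rw [← norm_ne_zero_iff, norm_smul_coe_sphere hr]; exact hr.ne'

theorem truncExt_smul (m : ℕ) {R r : ℝ} (hr : 0 < r) (hR : r ≤ R) (f : Sphere n → ℝ)
    (θ : Sphere n) : truncExt m R f (r • (θ : Space n)) = (r ^ m)⁻¹ * f θ := by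
  have h : r • (θ : Space n) ≠ 0 ∧ ‖r • (θ : Space n)‖ ≤ R :=
    ⟨smul_coe_sphere_ne_zero hr θ, by rwa [norm_smul_coe_sphere hr]⟩
  rw [truncExt, dif_pos h]
  simp only [norm_smul_coe_sphere hr]
  congr 2
  apply Subtype.ext
  simp [smul_smul, hr.ne']

theorem truncExt_smul_of_lt (m : ℕ) {R r : ℝ} (hr : 0 < r) (hR : R < r) (f : Sphere n → ℝ)
    (θ : Sphere n) : truncExt m R f (r • (θ : Space n)) = 0 := by
  rw [truncExt, dif_neg]
  rw [norm_smul_coe_sphere hr]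
  exact fun h => absurd h.2 (not_le.2 hR)

theorem pow_mul_inv_pow {m : ℕ} (hm : m < n) {r : ℝ} (hr : 0 < r) :
    r ^ (n - 1) * (r ^ m)⁻¹ = r ^ (n - 1 - m) := by
  rw [← div_eq_mul_inv, div_eq_iff (pow_pos hr _).ne', ← pow_add]
  congr 1; omega

/-- The polar Jacobian turns the singularity r^(-m) into the nonnegative power r^(n-1-m), and the
cutoff takes care of infinity. -/
theorem integrable_truncExt (hn : 2 ≤ n) {m : ℕ} (hm : m < n) (R : ℝ) {f : Sphere n → ℝ}
    (hf : Integrable f (surfaceMeasure n)) : Integrable (truncExt m R f) := by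
  rw [integrable_iff_polar hn]
  have h1 : Integrable ((Icc (0 : ℝ) R).indicator fun r => r ^ (n - 1 - m))
      (volume.restrict (Ioi 0)) :=
    ((integrable_indicator_iff measurableSet_Icc).2
      ((continuous_pow _).continuousOn.integrableOn_compact isCompact_Icc)).restrict
  refine (hf.mul_prod h1).congr ?_
  filter_upwards [ae_polar_pos] with z hz
  by_cases h : z.2 ≤ R
  · have : z.2 ∈ Icc (0 : ℝ) R := ⟨hz.le, h⟩
    rw [indicator_of_mem this, truncExt_smul m hz h, ← pow_mul_inv_pow hm hz]
    ring
  · have : z.2 ∉ Icc (0 : ℝ) R := fun h' => h h'.2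
    rw [indicator_of_notMem this, truncExt_smul_of_lt m hz (not_le.1 h)]
    ring

theorem IsWeakGradient.integrable_inner {u : Sphere n → ℝ} {Ψ : Sphere n → Space n}
    (h : IsWeakGradient u Ψ) (e : Space n) :
    Integrable (fun θ => inner ℝ (Ψ θ) e) (surfaceMeasure n) :=
  h.integrable_grad.inner_const e

theorem continuous_polar_smul : Continuous fun z : Sphere n × ℝ => z.2 • (z.1 : Space n) := by
  fun_prop

theorem fderiv_eq_zero_of_support_subset_ball {ψ : Space n → ℝ} {R : ℝ}
    (hR : Function.support ψ ⊆ Metric.ball 0 R) {x : Space n} (hx : R < ‖x‖) :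
    fderiv ℝ ψ x = 0 := by
  have : ψ =ᶠ[𝓝 x] fun _ => 0 := by
    filter_upwards [(isOpen_lt continuous_const continuous_norm).mem_nhds hx] with y hy
    by_contra h
    have := hR h
    rw [mem_ball_zero_iff] at this
    exact lt_asymm this hy
  rw [this.fderiv_eq]; simp

/-- The integrand is the derivative of r^(n-1) ψ(rθ), which vanishes at r = 0 because n ≥ 2 and for
large r because ψ has bounded support. -/
theorem integral_radial_derivative_eq_zero (hn : 2 ≤ n) {ψ : Space n → ℝ} (hψ : ContDiff ℝ 1 ψ)
    {R : ℝ} (hR : Function.support ψ ⊆ Metric.ball 0 R) (θ : Sphere n) :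
    ∫ r in Ioi (0 : ℝ), r ^ (n - 2) * (r * fderiv ℝ ψ (r • (θ : Space n)) θ
      + ((n : ℝ) - 1) * ψ (r • (θ : Space n))) = 0 := by
  let f : ℝ → ℝ := fun r => r ^ (n - 1) * ψ (r • (θ : Space n))
  have hf : ContDiff ℝ 1 f := by
    have : ContDiff ℝ 1 fun r : ℝ => r • (θ : Space n) := contDiff_id.smul contDiff_const
    exact (contDiff_id.pow _).mul (hψ.comp this)
  have hc : HasCompactSupport f := by
    refine HasCompactSupport.of_support_subset_isCompact (isCompact_Icc (a := -R) (b := R)) ?_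
    intro r hr
    have h1 : ψ (r • (θ : Space n)) ≠ 0 := right_ne_zero_of_mul hr
    have h2 := hR h1
    rw [mem_ball_zero_iff, norm_smul, norm_coe_sphere, mul_one, Real.norm_eq_abs, abs_lt] at h2
    exact ⟨h2.1.le, h2.2.le⟩
  have h0 : f 0 = 0 := by simp [f, show n - 1 ≠ 0 by omega]
  have key := hc.integral_Ioi_deriv_eq hf 0
  rw [h0, neg_zero] at key
  refine Eq.trans ?_ key
  refine integral_congr_ae (Eventually.of_forall fun r => ?_)
  have h1 : HasDerivAt (fun r : ℝ => r • (θ : Space n)) ((1 : ℝ) • (θ : Space n)) r :=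
    (hasDerivAt_id r).smul_const (θ : Space n)
  have h2 : HasDerivAt (fun r : ℝ => ψ (r • (θ : Space n)))
      (fderiv ℝ ψ (r • (θ : Space n)) ((1 : ℝ) • (θ : Space n))) r :=
    ((hψ.differentiable (by simp) (r • (θ : Space n))).hasFDerivAt).comp_hasDerivAt r h1
  have h3 : HasDerivAt f _ r := (hasDerivAt_pow (n - 1) r).mul h2
  simp only [h3.deriv, one_smul]
  obtain ⟨m, rfl⟩ := Nat.exists_eq_add_of_le' hn
  simp only [Nat.add_sub_cancel, show m + 2 - 1 = m + 1 by omega]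
  push_cast
  ring

/-- The weak gradient of the extension that is homogeneous of degree `0`. -/
theorem IsWeakGradient.truncExt_identity (hn : 2 ≤ n) {u : Sphere n → ℝ}
    {Ψ : Sphere n → Space n} (h : IsWeakGradient u Ψ) {R : ℝ} (e : Space n) {ψ : Space n → ℝ}
    (hψ : ContDiff ℝ ∞ ψ) (hR : Function.support ψ ⊆ Metric.ball 0 R) :
    ∫ x, ψ x * truncExt 1 R (fun θ => inner ℝ (Ψ θ) e) x
      = - ∫ x, truncExt 0 R u x * fderiv ℝ ψ x e := by
  have hψ1 : ContDiff ℝ 1 ψ := hψ.of_le (by norm_cast)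
  have hψ0 : ∀ (r : ℝ) (θ : Sphere n), 0 < r → R < r → ψ (r • (θ : Space n)) = 0 := by
    intro r θ h0 hr
    by_contra hne
    have := hR hne
    rw [mem_ball_zero_iff, norm_smul_coe_sphere h0] at this
    exact lt_asymm this hr
  have hcψ : Continuous fun z : Sphere n × ℝ => ψ (z.2 • (z.1 : Space n)) :=
    hψ.continuous.comp continuous_polar_smul
  have hcd : Continuous fun z : Sphere n × ℝ => fderiv ℝ ψ (z.2 • (z.1 : Space n)) :=
    (hψ1.continuous_fderiv (by simp)).comp continuous_polar_smul
  -- A and B are the polar densities of the two sides of the identity. B - C is r^(n-2) times the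
  -- divergence of the tangential projection of ψ(r·)e, and C is a constant multiple of an exact
  -- radial derivative along each ray.
  let A : Sphere n × ℝ → ℝ := fun z => z.2 ^ (n - 2) * ψ (z.2 • (z.1 : Space n))
  let B : Sphere n × ℝ → ℝ := fun z => z.2 ^ (n - 1) * fderiv ℝ ψ (z.2 • (z.1 : Space n)) e
  let C : Sphere n × ℝ → ℝ := fun z => inner ℝ (z.1 : Space n) e *
    (z.2 ^ (n - 2) * (z.2 * fderiv ℝ ψ (z.2 • (z.1 : Space n)) z.1
      + ((n : ℝ) - 1) * ψ (z.2 • (z.1 : Space n))))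
  have hA : Continuous A := (continuous_snd.pow _).mul hcψ
  have hB : Continuous B := (continuous_snd.pow _).mul (hcd.clm_apply continuous_const)
  have hC : Continuous C := by
    have h1 : Continuous fun z : Sphere n × ℝ => (z.1 : Space n) :=
      continuous_subtype_val.comp continuous_fst
    exact (h1.inner continuous_const).mul ((continuous_snd.pow _).mul
      ((continuous_snd.mul (hcd.clm_apply h1)).add (continuous_const.mul hcψ)))
  have hz : ∀ z : Sphere n × ℝ, max R 0 < z.2 →
      ψ (z.2 • (z.1 : Space n)) = 0 ∧ fderiv ℝ ψ (z.2 • (z.1 : Space n)) = 0 := by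
    intro z hz
    have h0 : 0 < z.2 := (le_max_right _ _).trans_lt hz
    have h1 : R < z.2 := (le_max_left _ _).trans_lt hz
    exact ⟨hψ0 _ _ h0 h1, fderiv_eq_zero_of_support_subset_ball hR
      (by rwa [norm_smul_coe_sphere h0])⟩
  have iA := integrable_mul_continuous_polar (h.integrable_inner e) hA (R := max R 0)
    fun z hzR => by simp [A, (hz z hzR).1]
  have iB := integrable_mul_continuous_polar h.integrable_fun hB (R := max R 0)
    fun z hzR => by simp [B, (hz z hzR).2]
  have iC := integrable_mul_continuous_polar h.integrable_fun hC (R := max R 0)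
    fun z hzR => by simp [C, (hz z hzR).1, (hz z hzR).2]
  have hL : ∫ x, ψ x * truncExt 1 R (fun θ => inner ℝ (Ψ θ) e) x
      = ∫ z, inner ℝ (Ψ z.1) e * A z ∂(polarMeasure n) := by
    rw [integral_polar hn]
    refine integral_congr_ae ?_
    filter_upwards [ae_polar_pos] with z hz0
    by_cases hzR : z.2 ≤ R
    · have := pow_mul_inv_pow (show 1 < n by omega) hz0
      rw [truncExt_smul 1 hz0 hzR]
      simp only [A]
      rw [show n - 2 = n - 1 - 1 by omega, ← this]
      ring
    · simp [A, hψ0 _ z.1 hz0 (not_le.1 hzR)]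
  have hRt : ∫ x, truncExt 0 R u x * fderiv ℝ ψ x e
      = ∫ z, u z.1 * B z ∂(polarMeasure n) := by
    rw [integral_polar hn]
    refine integral_congr_ae ?_
    filter_upwards [ae_polar_pos] with z hz0
    by_cases hzR : z.2 ≤ R
    · rw [truncExt_smul 0 hz0 hzR]
      simp only [B]
      ring
    · have : fderiv ℝ ψ (z.2 • (z.1 : Space n)) = 0 :=
        fderiv_eq_zero_of_support_subset_ball hR
          (by rw [norm_smul_coe_sphere hz0]; exact not_le.1 hzR)
      simp [B, this]
  have hC0 : ∫ z, u z.1 * C z ∂(polarMeasure n) = 0 := by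
    rw [integral_prod _ iC]
    refine integral_eq_zero_of_ae (Eventually.of_forall fun θ => ?_)
    simp only [C, Pi.zero_apply]
    rw [integral_const_mul, integral_const_mul, integral_radial_derivative_eq_zero hn hψ1 hR]
    simp
  -- On each sphere of radius r, the definition of the weak gradient is used with the tangent field
  -- ψ(ry)(e - (y·e)y). Integrating over r then removes C.
  have hslice : ∀ r : ℝ, 0 < r → ∫ θ, inner ℝ (Ψ θ) e * A (θ, r) ∂(surfaceMeasure n)
      = - ∫ θ, (u θ * B (θ, r) - u θ * C (θ, r)) ∂(surfaceMeasure n) := by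
    intro r hr
    let V : Space n → Space n := fun y => ψ (r • y) • (e - inner ℝ y e • y)
    have hV : IsSmoothTangentField V := by
      refine ⟨?_, fun x => ?_⟩
      · exact (hψ.comp (contDiff_const_smul r)).smul
          (contDiff_const.sub ((contDiff_id.inner ℝ contDiff_const).smul contDiff_id))
      · simp only [V]
        rw [inner_smul_left, inner_sub_left, inner_smul_left, inner_coe_self, real_inner_comm]
        simp
    have hdiv : ∀ θ : Sphere n, r ^ (n - 2) * (u θ * surfaceDiv V θ)
        = u θ * B (θ, r) - u θ * C (θ, r) := by
      intro θ
      have h1 : HasFDerivAt (fun y : Space n => ψ (r • y))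
          ((fderiv ℝ ψ (r • (θ : Space n))).comp (r • ContinuousLinearMap.id ℝ (Space n))) θ :=
        ((hψ1.differentiable (by simp) (r • (θ : Space n))).hasFDerivAt).comp (θ : Space n)
          ((hasFDerivAt_id (θ : Space n)).const_smul r)
      rw [surfaceDiv_smul_tangent h1 e]
      have h2 : r ^ (n - 1) = r ^ (n - 2) * r := by
        rw [← pow_succ]; congr 1; omega
      simp only [B, C, h2]
      simp
      ring
    have hid := h.integral_eq V hV
    have hl : ∫ θ, inner ℝ (Ψ θ) e * A (θ, r) ∂(surfaceMeasure n)
        = r ^ (n - 2) * ∫ θ, inner ℝ (Ψ θ) (V θ) ∂(surfaceMeasure n) := by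
      rw [← integral_const_mul]
      refine integral_congr_ae ?_
      filter_upwards [h.tangent] with θ hθ
      simp only [A, V]
      rw [inner_smul_right, inner_sub_right, inner_smul_right, hθ]
      ring
    rw [hl, hid, mul_neg, ← integral_const_mul]
    simp only [hdiv]
  rw [hL, hRt, integral_prod_symm _ iA]
  have h1 : ∫ r in Ioi (0 : ℝ), ∫ θ, inner ℝ (Ψ θ) e * A (θ, r) ∂(surfaceMeasure n)
      = ∫ r in Ioi (0 : ℝ), - ∫ θ, (u θ * B (θ, r) - u θ * C (θ, r)) ∂(surfaceMeasure n) :=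
    setIntegral_congr_fun measurableSet_Ioi fun r hr => hslice r hr
  rw [h1, integral_neg]
  have h2 := integral_prod_symm _ (iB.sub iC)
  simp only [Pi.sub_apply] at h2
  rw [← h2, integral_sub iB iC, hC0, sub_zero]

end RadialExtension

/-! ### The chain rule for weak gradients on the sphere. -/

section ChainRule

theorem integrable_mul_continuous_sphere {f g : Sphere n → ℝ}
    (hf : Integrable f (surfaceMeasure n)) (hg : Continuous g) :
    Integrable (fun x => f x * g x) (surfaceMeasure n) := by
  obtain ⟨C, hC⟩ := (isCompact_univ (X := Sphere n)).exists_bound_of_continuousOn hg.continuousOn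
  refine (hf.bdd_mul (c := C) hg.aestronglyMeasurable
    (Eventually.of_forall fun x => hC x (mem_univ _))).congr (Eventually.of_forall fun x => ?_)
  simp [mul_comm]

theorem inner_single_one (v : Space n) (i : Fin n) :
    inner ℝ v (EuclideanSpace.single i (1 : ℝ)) = v i := by
  rw [EuclideanSpace.inner_single_right]; simp

theorem hasFDerivAt_norm_smul_coe {r : ℝ} (hr : 0 < r) (θ : Sphere n) :
    HasFDerivAt (fun y : Space n => ‖y‖) (innerSL ℝ (θ : Space n)) (r • (θ : Space n)) := by
  have h1 := (hasStrictFDerivAt_norm_sq (r • (θ : Space n))).hasFDerivAt.sqrt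
    (by rw [norm_smul_coe_sphere hr]; positivity)
  simp only [Real.sqrt_sq (norm_nonneg _), norm_smul_coe_sphere hr] at h1
  convert! h1 using 1
  ext v
  simp only [Real.sqrt_sq hr.le, innerSL_apply_apply, smul_apply, inner_smul_left,
    RCLike.conj_to_real, smul_eq_mul, nsmul_eq_mul, Nat.cast_ofNat]
  field_simp

/-- The trace of the derivative of a tangent field extended radially with a radial weight. -/
theorem trace_fderiv_radial {V : Space n → Space n} (hV : IsSmoothTangentField V) {a : ℝ → ℝ}
    (ha : Differentiable ℝ a) {r : ℝ} (hr : 0 < r) (θ : Sphere n) :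
    ∑ i, (fderiv ℝ (fun x : Space n => a ‖x‖ • V (‖x‖⁻¹ • x)) (r • (θ : Space n))
      (EuclideanSpace.single i 1)) i = a r * r⁻¹ * surfaceDiv V θ := by
  have hnorm := hasFDerivAt_norm_smul_coe hr θ
  have hnr : ‖r • (θ : Space n)‖ = r := norm_smul_coe_sphere hr θ
  have hpt : ‖r • (θ : Space n)‖⁻¹ • r • (θ : Space n) = θ := by
    rw [hnr, smul_smul, inv_mul_cancel₀ hr.ne', one_smul]
  have h1 : HasFDerivAt (fun x : Space n => a ‖x‖) (deriv a r • innerSL ℝ (θ : Space n))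
      (r • (θ : Space n)) := by
    have := (ha ‖r • (θ : Space n)‖).hasDerivAt.comp_hasFDerivAt _ hnorm
    rwa [hnr] at this
  have h2 : HasFDerivAt (fun x : Space n => ‖x‖⁻¹)
      ((-(r ^ 2)⁻¹) • innerSL ℝ (θ : Space n)) (r • (θ : Space n)) := by
    have := (hasDerivAt_inv (x := ‖r • (θ : Space n)‖) (by rw [hnr]; exact hr.ne')).comp_hasFDerivAt
      _ hnorm
    rwa [hnr] at this
  have h3 := h2.smul (hasFDerivAt_id (r • (θ : Space n)))
  have h4 : HasFDerivAt V (fderiv ℝ V θ) (‖r • (θ : Space n)‖⁻¹ • id (r • (θ : Space n))) := by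
    rw [id, hpt]
    exact (hV.smooth.differentiable (by simp) _).hasFDerivAt
  have h6 : HasFDerivAt (fun x : Space n => a ‖x‖ • V (‖x‖⁻¹ • x)) _ (r • (θ : Space n)) :=
    h1.smul (HasFDerivAt.comp (g := V) (r • (θ : Space n)) h4 h3)
  rw [h6.fderiv]
  have e1 : ∑ i, (innerSL ℝ (θ : Space n)) (EuclideanSpace.single i 1) * (V θ) i
      = inner ℝ (θ : Space n) (V θ) := sum_clm_apply_mul (innerSL ℝ (θ : Space n)) (V θ)
  have e2 : ∑ i, (innerSL ℝ (θ : Space n)) (EuclideanSpace.single i 1) * (fderiv ℝ V θ θ) i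
      = inner ℝ (θ : Space n) (fderiv ℝ V θ θ) :=
    sum_clm_apply_mul (innerSL ℝ (θ : Space n)) (fderiv ℝ V θ θ)
  have ht : inner ℝ (θ : Space n) (V θ) = 0 := by
    rw [real_inner_comm]; exact hV.tangent θ
  rw [ht] at e1
  -- The derivative of x/‖x‖ at rθ is r⁻¹ times the projection onto θ^⊥. Its normal correction
  -- yields the subtracted term in `surfaceDiv`; the term with a' sums to zero since V is tangent.
  have key : ∀ i : Fin n, ((a ‖r • (θ : Space n)‖ • (fderiv ℝ V θ).comp
      (‖r • (θ : Space n)‖⁻¹ • ContinuousLinearMap.id ℝ (Space n)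
        + ((-(r ^ 2)⁻¹) • innerSL ℝ (θ : Space n)).smulRight (id (r • (θ : Space n))))
      + (deriv a r • innerSL ℝ (θ : Space n)).smulRight
        (V (‖r • (θ : Space n)‖⁻¹ • id (r • (θ : Space n)))))
        (EuclideanSpace.single i 1)) i
      = a r * r⁻¹ * (fderiv ℝ V θ (EuclideanSpace.single i 1)) i
        - a r * r⁻¹ * ((innerSL ℝ (θ : Space n)) (EuclideanSpace.single i 1) * (fderiv ℝ V θ θ) i)
        + deriv a r * ((innerSL ℝ (θ : Space n)) (EuclideanSpace.single i 1) * (V θ) i) := by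
    intro i
    rw [id, hpt, hnr]
    simp
    field_simp
    ring
  refine (Finset.sum_congr rfl fun i _ => key i).trans ?_
  rw [Finset.sum_add_distrib, Finset.sum_sub_distrib, ← Finset.mul_sum, ← Finset.mul_sum,
    ← Finset.mul_sum, e1, e2, surfaceDiv, real_inner_comm]
  ring

/-- Extend u to be 0-homogeneous, apply the Euclidean chain rule coordinate by coordinate to the
components of a(‖x‖)V(x/‖x‖), and sum. In polar coordinates both sides factor into the desired
spherical integral and the same radial integral, which cancels. -/
theorem IsWeakGradient.chain_rule (hn : 2 ≤ n) {u : Sphere n → ℝ} {Ψ : Sphere n → Space n}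
    (h : IsWeakGradient u Ψ) {β : ℝ → ℝ} (hβ : ContDiff ℝ 1 β) {M : ℝ}
    (hM : ∀ t, |deriv β t| ≤ M) :
    IsWeakGradient (fun x => β (u x)) (fun x => deriv β (u x) • Ψ x) := by
  have hLip : ∀ s t, |β s - β t| ≤ M * |s - t| := by
    intro s t
    simpa [Real.norm_eq_abs] using Convex.norm_image_sub_le_of_norm_deriv_le (𝕜 := ℝ) (f := β)
      (s := Set.univ) (fun x _ => hβ.differentiable (by simp) x) (fun x _ => hM x) convex_univ
      (Set.mem_univ t) (Set.mem_univ s)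
  have hβc : Continuous (deriv β) := hβ.continuous_deriv (by simp)
  have hβm : AEStronglyMeasurable (fun x => deriv β (u x)) (surfaceMeasure n) :=
    hβc.comp_aestronglyMeasurable h.integrable_fun.1
  have hiβ : Integrable (fun x => β (u x)) (surfaceMeasure n) := by
    refine ((integrable_const |β 0|).add (h.integrable_fun.abs.const_mul M)).mono'
      (hβ.continuous.comp_aestronglyMeasurable h.integrable_fun.1)
      (Eventually.of_forall fun x => ?_)
    have h1 := hLip (u x) 0
    rw [sub_zero] at h1
    have h2 := abs_sub_abs_le_abs_sub (β (u x)) (β 0)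
    simp only [Pi.add_apply, Real.norm_eq_abs]
    linarith
  have hbd : ∀ᵐ x ∂(surfaceMeasure n), ‖deriv β (u x)‖ ≤ M := Eventually.of_forall fun x => hM _
  refine ⟨hiβ, h.integrable_grad.bdd_smul M hβm hbd, ?_, fun V hV => ?_⟩
  · filter_upwards [h.tangent] with x hx
    rw [inner_smul_left, hx, mul_zero]
  -- The radial cutoff lives on (1, 3): away from the origin, where x/‖x‖ is singular, and inside
  -- the ball of radius R = 3. The extensions below are cut at 3 + 1, the radius R + 1 required by
  -- `weak_chain_rule`.
  let a : ContDiffBump (2 : ℝ) := ⟨1 / 2, 1, by norm_num, by norm_num⟩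
  have ha1 : ContDiff ℝ 1 a := a.contDiff
  have hasupp : ∀ r, a r ≠ 0 → 1 < r ∧ r < 3 := by
    intro r hr
    have : r ∈ Function.support a := hr
    rw [a.support_eq, Metric.mem_ball, Real.dist_eq, abs_lt] at this
    change -1 < r - 2 ∧ r - 2 < 1 at this
    constructor <;> linarith [this.1, this.2]
  let W : Space n → Space n := fun x => a ‖x‖ • V (‖x‖⁻¹ • x)
  have hWsupp : ∀ x, W x ≠ 0 → 1 < ‖x‖ ∧ ‖x‖ < 3 := fun x hx =>
    hasupp _ fun h0 => hx (by simp [W, h0])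
  have hW : ContDiff ℝ 1 W := by
    rw [contDiff_iff_contDiffAt]
    intro x
    rcases eq_or_ne x 0 with rfl | hx
    · have : W =ᶠ[𝓝 0] fun _ => 0 := by
        filter_upwards [Metric.ball_mem_nhds (0 : Space n) one_pos] with y hy
        by_contra hne
        rw [mem_ball_zero_iff] at hy
        exact lt_asymm hy (hWsupp y hne).1
      exact contDiffAt_const.congr_of_eventuallyEq this
    · have hnx : ContDiffAt ℝ 1 (fun y : Space n => ‖y‖) x := contDiffAt_norm ℝ hx
      refine (ha1.contDiffAt.comp x hnx).smul ?_
      have h1 : ContDiffAt ℝ 1 (fun y : Space n => ‖y‖⁻¹ • y) x :=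
        (hnx.inv (norm_ne_zero_iff.2 hx)).smul contDiffAt_id
      exact (hV.smooth.of_le (by norm_cast)).contDiffAt.comp x h1
  have hWi : ∀ i, ContDiff ℝ 1 fun x => W x i := fun i =>
    (EuclideanSpace.proj (𝕜 := ℝ) i).contDiff.comp hW
  have hWis : ∀ i, Function.support (fun x => W x i) ⊆ Metric.ball 0 3 := by
    intro i x hx
    rw [mem_ball_zero_iff]
    exact (hWsupp x fun h0 => hx (by simp [h0])).2
  have hWic : ∀ i, HasCompactSupport fun x => W x i := fun i =>
    HasCompactSupport.of_support_subset_isCompact (isCompact_closedBall 0 3)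
      ((hWis i).trans Metric.ball_subset_closedBall)
  have hWd : ∀ i x v, fderiv ℝ (fun x => W x i) x v = (fderiv ℝ W x v) i := by
    intro i x v
    have h1 := ((EuclideanSpace.proj (𝕜 := ℝ) i : Space n →L[ℝ] ℝ).hasFDerivAt).comp x
      (hW.differentiable (by simp) x).hasFDerivAt
    have h2 : fderiv ℝ (fun x => W x i) x = _ := h1.fderiv
    rw [h2]; rfl
  -- The common radial factor: the Jacobian r^(n-1) times the r⁻¹ coming from the gradient on one
  -- side and from the divergence on the other.
  let k : ℝ → ℝ := fun r => r ^ (n - 1 - 1) * a r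
  have hchain : ∀ i : Fin n,
      ∫ x, W x i * (deriv β (truncExt 0 (3 + 1) u x) * truncExt 1 (3 + 1)
        (fun θ => inner ℝ (Ψ θ) (EuclideanSpace.single i (1 : ℝ))) x)
      = - ∫ x, β (truncExt 0 (3 + 1) u x)
        * fderiv ℝ (fun x => W x i) x (EuclideanSpace.single i 1) := fun i =>
    weak_chain_rule (integrable_truncExt hn (by omega) _ h.integrable_fun)
      (integrable_truncExt hn (by omega) _ (h.integrable_inner _))
      (fun ψ hψ _ hs => h.truncExt_identity hn _ hψ hs) hβ hM (hWi i) (hWic i) (hWis i)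
  have hLHS : ∀ i : Fin n,
      ∫ x, W x i * (deriv β (truncExt 0 (3 + 1) u x) * truncExt 1 (3 + 1)
        (fun θ => inner ℝ (Ψ θ) (EuclideanSpace.single i (1 : ℝ))) x)
      = (∫ θ, deriv β (u θ) * (Ψ θ) i * (V θ) i ∂(surfaceMeasure n))
        * ∫ r in Ioi (0 : ℝ), k r := by
    intro i
    rw [integral_polar hn, ← integral_prod_mul]
    refine integral_congr_ae ?_
    filter_upwards [ae_polar_pos] with z hz
    by_cases hz4 : z.2 ≤ 3 + 1
    · rw [truncExt_smul 0 hz hz4, truncExt_smul 1 hz hz4]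
      simp only [W, k, norm_smul_coe_sphere hz, smul_smul, inv_mul_cancel₀ hz.ne', one_smul]
      rw [← pow_mul_inv_pow (show 1 < n by omega) hz, inner_single_one]
      simp
      ring
    · have h0 : a z.2 = 0 := by
        by_contra hne
        linarith [(hasupp _ hne).2]
      simp [W, k, norm_smul_coe_sphere hz, h0]
  let K : Fin n → Sphere n × ℝ → ℝ := fun i z =>
    z.2 ^ (n - 1) * (fderiv ℝ W (z.2 • (z.1 : Space n)) (EuclideanSpace.single i 1)) i
  have hK : ∀ i, Integrable (fun z => β (u z.1) * K i z) (polarMeasure n) := by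
    intro i
    refine integrable_mul_continuous_polar hiβ (R := 3) ?_ ?_
    · refine (continuous_snd.pow _).mul ((EuclideanSpace.proj (𝕜 := ℝ) i).continuous.comp
        (((hW.continuous_fderiv (by simp)).comp continuous_polar_smul).clm_apply continuous_const))
    · intro z hz
      have h1 := fderiv_eq_zero_of_support_subset_ball (hWis i)
        (x := z.2 • (z.1 : Space n)) (by rw [norm_smul_coe_sphere (by linarith)]; exact hz)
      simp only [K]
      rw [← hWd, h1]
      simp
  have hRHS : ∀ i : Fin n, ∫ x, β (truncExt 0 (3 + 1) u x)
        * fderiv ℝ (fun x => W x i) x (EuclideanSpace.single i 1)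
      = ∫ z, β (u z.1) * K i z ∂(polarMeasure n) := by
    intro i
    rw [integral_polar hn]
    refine integral_congr_ae ?_
    filter_upwards [ae_polar_pos] with z hz
    by_cases hz4 : z.2 ≤ 3 + 1
    · rw [truncExt_smul 0 hz hz4, hWd]
      simp only [K, pow_zero, inv_one, one_mul]
      ring
    · have h1 := fderiv_eq_zero_of_support_subset_ball (hWis i)
        (x := z.2 • (z.1 : Space n)) (by rw [norm_smul_coe_sphere hz]; linarith)
      simp only [K]
      rw [← hWd, h1]
      simp
  have hsumR : ∑ i, ∫ z, β (u z.1) * K i z ∂(polarMeasure n)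
      = (∫ θ, β (u θ) * surfaceDiv V θ ∂(surfaceMeasure n)) * ∫ r in Ioi (0 : ℝ), k r := by
    rw [← integral_finsetSum _ fun i _ => hK i, ← integral_prod_mul]
    refine integral_congr_ae ?_
    filter_upwards [ae_polar_pos] with z hz
    rw [← Finset.mul_sum]
    simp only [K, k]
    rw [← Finset.mul_sum, trace_fderiv_radial hV (ha1.differentiable (by simp)) hz,
      ← pow_mul_inv_pow (show 1 < n by omega) hz]
    ring
  have hsumL : ∑ i, ∫ θ, deriv β (u θ) * (Ψ θ) i * (V θ) i ∂(surfaceMeasure n)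
      = ∫ θ, inner ℝ (deriv β (u θ) • Ψ θ) (V θ) ∂(surfaceMeasure n) := by
    rw [← integral_finsetSum]
    · refine integral_congr_ae (Eventually.of_forall fun θ => ?_)
      simp only
      rw [inner_smul_left, PiLp.inner_apply, Finset.mul_sum]
      refine Finset.sum_congr rfl fun i _ => ?_
      simp
      ring
    · intro i _
      have h1 : Integrable (fun θ => (Ψ θ) i) (surfaceMeasure n) := by
        simpa only [inner_single_one] using h.integrable_inner (EuclideanSpace.single i (1 : ℝ))
      refine integrable_mul_continuous_sphere (h1.bdd_mul hβm hbd) ?_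
      exact (EuclideanSpace.proj (𝕜 := ℝ) i).continuous.comp
        (hV.smooth.continuous.comp continuous_subtype_val)
  have hk : (∫ r in Ioi (0 : ℝ), k r) ≠ 0 := by
    have hkc : Continuous k := (continuous_pow _).mul ha1.continuous
    have hks : HasCompactSupport k := a.hasCompactSupport.mul_left
    refine ne_of_gt ((setIntegral_pos_iff_support_of_nonneg_ae ?_
      (hkc.integrable_of_hasCompactSupport hks).integrableOn).2 ?_)
    · filter_upwards [ae_restrict_mem measurableSet_Ioi] with r hr
      exact mul_nonneg (pow_nonneg (le_of_lt hr) _) a.nonneg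
    · refine IsOpen.measure_pos _ ((hkc.isOpen_support).inter isOpen_Ioi) ⟨2, ?_, two_pos (α := ℝ)⟩
      have : a 2 = 1 := a.one_of_mem_closedBall (Metric.mem_closedBall_self (by norm_num))
      simp [k, this]
  have htot := Finset.sum_congr rfl fun i (_ : i ∈ Finset.univ) => hchain i
  simp only [hLHS, hRHS] at htot
  rw [← Finset.sum_mul, hsumL, Finset.sum_neg_distrib, hsumR, ← neg_mul] at htot
  exact mul_right_cancel₀ hk htot

end ChainRule

/-! ### The weak gradient of |u|^p by truncation. -/

section Power

theorem continuous_surfaceDiv {V : Space n → Space n} (hV : IsSmoothTangentField V) :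
    Continuous (surfaceDiv V) := by
  have h1 : Continuous fun x : Sphere n => fderiv ℝ V x :=
    (hV.smooth.continuous_fderiv (by simp)).comp continuous_subtype_val
  refine Continuous.sub (continuous_finsetSum _ fun i _ => ?_) ?_
  · exact (EuclideanSpace.proj (𝕜 := ℝ) i).continuous.comp (h1.clm_apply continuous_const)
  · exact (h1.clm_apply continuous_subtype_val).inner continuous_subtype_val

theorem abs_deriv_abs_rpow {p : ℝ} (hp : 1 < p) (t : ℝ) :
    |p * |t| ^ (p - 2) * t| = p * |t| ^ (p - 1) := by
  rw [abs_mul, abs_mul, abs_of_pos (by linarith : 0 < p),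
    abs_of_nonneg (Real.rpow_nonneg (abs_nonneg t) _)]
  rcases eq_or_ne t 0 with rfl | ht
  · rw [abs_zero, mul_zero, Real.zero_rpow (by linarith), mul_zero]
  · rw [mul_assoc, ← Real.rpow_add_one (abs_pos.2 ht).ne']
    congr 2; ring

theorem continuous_deriv_abs_rpow {p : ℝ} (hp : 1 < p) :
    Continuous fun t : ℝ => p * |t| ^ (p - 2) * t := by
  have h1 : ContDiff ℝ 1 fun t : ℝ => ‖t‖ ^ p := contDiff_norm_rpow hp
  have h2 : deriv (fun t : ℝ => ‖t‖ ^ p) = fun t : ℝ => p * |t| ^ (p - 2) * t := by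
    ext t
    exact (hasDerivAt_abs_rpow t hp).deriv
  rw [← h2]
  exact h1.continuous_deriv (by simp)

/-- Functions with bounded derivative that approximate `|t| ^ p`. -/
def truncPow (p : ℝ) (k : ℕ) (t : ℝ) : ℝ :=
  ∫ s in (0 : ℝ)..t, p * |max (-(k : ℝ)) (min s k)| ^ (p - 2) * max (-(k : ℝ)) (min s k)

theorem continuous_truncPow_integrand {p : ℝ} (hp : 1 < p) (k : ℕ) : Continuous fun s : ℝ =>
    p * |max (-(k : ℝ)) (min s k)| ^ (p - 2) * max (-(k : ℝ)) (min s k) :=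
  (continuous_deriv_abs_rpow hp).comp (by fun_prop : Continuous fun s : ℝ =>
    max (-(k : ℝ)) (min s k))

theorem deriv_truncPow {p : ℝ} (hp : 1 < p) (k : ℕ) (t : ℝ) : deriv (truncPow p k) t =
    p * |max (-(k : ℝ)) (min t k)| ^ (p - 2) * max (-(k : ℝ)) (min t k) :=
  (continuous_truncPow_integrand hp k).deriv_integral _ _ _

theorem contDiff_truncPow {p : ℝ} (hp : 1 < p) (k : ℕ) : ContDiff ℝ 1 (truncPow p k) := by
  rw [contDiff_one_iff_deriv]
  refine ⟨fun t => ?_, ?_⟩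
  · exact ((continuous_truncPow_integrand hp k).integral_hasStrictDerivAt 0 t).hasDerivAt
      |>.differentiableAt
  · rw [funext (deriv_truncPow hp k)]
    exact continuous_truncPow_integrand hp k

theorem abs_clamp_le (k : ℕ) (t : ℝ) : |max (-(k : ℝ)) (min t k)| ≤ |t| := by
  have hk : (0 : ℝ) ≤ k := Nat.cast_nonneg k
  rw [abs_le]
  constructor
  · rcases le_total 0 t with h | h
    · exact (neg_nonpos.2 (abs_nonneg t)).trans ((le_min h hk).trans (le_max_right _ _))
    · rw [abs_of_nonpos h, neg_neg]
      exact (le_min le_rfl (h.trans hk)).trans (le_max_right _ _)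
  · exact max_le ((neg_nonpos.2 hk).trans (abs_nonneg t)) ((min_le_left _ _).trans (le_abs_self t))

theorem abs_clamp_le_nat (k : ℕ) (t : ℝ) : |max (-(k : ℝ)) (min t k)| ≤ k := by
  have hk : (0 : ℝ) ≤ k := Nat.cast_nonneg k
  exact abs_le.2 ⟨le_max_left _ _, max_le (by linarith) (min_le_right _ _)⟩

theorem clamp_of_abs_le {k : ℕ} {t : ℝ} (h : |t| ≤ k) : max (-(k : ℝ)) (min t k) = t := by
  rw [abs_le] at h
  rw [min_eq_left h.2, max_eq_right h.1]

theorem abs_deriv_truncPow_le_nat {p : ℝ} (hp : 1 < p) (k : ℕ) (t : ℝ) :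
    |deriv (truncPow p k) t| ≤ p * (k : ℝ) ^ (p - 1) := by
  rw [deriv_truncPow hp, abs_deriv_abs_rpow hp]
  exact mul_le_mul_of_nonneg_left (Real.rpow_le_rpow (abs_nonneg _) (abs_clamp_le_nat k t) (by linarith))
    (by linarith)

theorem abs_deriv_truncPow_le {p : ℝ} (hp : 1 < p) (k : ℕ) (t : ℝ) :
    |deriv (truncPow p k) t| ≤ p * |t| ^ (p - 1) := by
  rw [deriv_truncPow hp, abs_deriv_abs_rpow hp]
  exact mul_le_mul_of_nonneg_left (Real.rpow_le_rpow (abs_nonneg _) (abs_clamp_le k t) (by linarith))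
    (by linarith)

theorem abs_truncPow_le {p : ℝ} (hp : 1 < p) (k : ℕ) (t : ℝ) :
    |truncPow p k t| ≤ p * |t| ^ p := by
  have h1 : ‖truncPow p k t‖ ≤ (p * |t| ^ (p - 1)) * |t - 0| := by
    refine intervalIntegral.norm_integral_le_of_norm_le_const fun s hs => ?_
    rw [Real.norm_eq_abs, abs_deriv_abs_rpow hp]
    have hst : |s| ≤ |t| := by
      rcases le_total 0 t with h | h
      · rw [uIoc_of_le h] at hs
        rw [abs_of_pos hs.1, abs_of_nonneg h]; exact hs.2
      · rw [uIoc_of_ge h] at hs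
        rw [abs_of_nonpos hs.2, abs_of_nonpos h]; linarith [hs.1]
    exact mul_le_mul_of_nonneg_left (Real.rpow_le_rpow (abs_nonneg _) ((abs_clamp_le k s).trans hst) (by linarith))
      (by linarith)
  rw [sub_zero, mul_assoc, Real.norm_eq_abs] at h1
  refine h1.trans_eq ?_
  rcases eq_or_ne t 0 with rfl | ht
  · rw [abs_zero, Real.zero_rpow (by linarith : p ≠ 0), mul_zero]
  · rw [← Real.rpow_add_one (abs_pos.2 ht).ne']
    congr 2; ring

theorem truncPow_of_abs_le {p : ℝ} (hp : 1 < p) {k : ℕ} {t : ℝ} (h : |t| ≤ k) :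
    truncPow p k t = |t| ^ p := by
  have h1 : truncPow p k t = ∫ s in (0 : ℝ)..t, p * |s| ^ (p - 2) * s := by
    refine intervalIntegral.integral_congr fun s hs => ?_
    have hst : |s| ≤ |t| := by
      rcases le_total 0 t with h | h
      · rw [uIcc_of_le h] at hs
        rw [abs_of_nonneg hs.1, abs_of_nonneg h]; exact hs.2
      · rw [uIcc_of_ge h] at hs
        rw [abs_of_nonpos hs.2, abs_of_nonpos h]; linarith [hs.1]
    rw [clamp_of_abs_le (hst.trans h)]
  rw [h1, intervalIntegral.integral_eq_sub_of_hasDerivAt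
    (fun s _ => hasDerivAt_abs_rpow s hp)
    ((continuous_deriv_abs_rpow hp).intervalIntegrable _ _)]
  rw [abs_zero, Real.zero_rpow (by linarith : p ≠ 0), sub_zero]

theorem deriv_truncPow_of_abs_le {p : ℝ} (hp : 1 < p) {k : ℕ} {t : ℝ} (h : |t| ≤ k) :
    deriv (truncPow p k) t = p * |t| ^ (p - 2) * t := by
  rw [deriv_truncPow hp, clamp_of_abs_le h]

/-- The chain rule for `|u| ^ p`. -/
theorem IsWeakGradient.abs_rpow (hn : 2 ≤ n) {u : Sphere n → ℝ} {Ψ : Sphere n → Space n}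
    (h : IsWeakGradient u Ψ) {p : ℝ} (hp : 1 < p)
    (hu : Integrable (fun x => |u x| ^ p) (surfaceMeasure n))
    (hΨ : Integrable (fun x => |u x| ^ (p - 1) * ‖Ψ x‖) (surfaceMeasure n)) :
    IsWeakGradient (fun x => |u x| ^ p) (fun x => (p * |u x| ^ (p - 2) * u x) • Ψ x) := by
  have hint : Integrable (fun x => (p * |u x| ^ (p - 2) * u x) • Ψ x) (surfaceMeasure n) := by
    refine (hΨ.const_mul p).mono' (((continuous_deriv_abs_rpow hp).comp_aestronglyMeasurable
      h.integrable_fun.1).smul h.integrable_grad.1) (Eventually.of_forall fun x => ?_)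
    rw [norm_smul, Real.norm_eq_abs, abs_deriv_abs_rpow hp, mul_assoc]
  refine ⟨hu, hint, ?_, fun V hV => ?_⟩
  · filter_upwards [h.tangent] with x hx
    rw [inner_smul_left, hx, mul_zero]
  -- Clamping the derivative at level k makes it bounded, so the chain rule applies. At each point
  -- the truncations are stationary once k ≥ |u x|, and they are dominated by p|u|^p and
  -- p|u|^(p-1)‖Ψ‖.
  have hk : ∀ k, IsWeakGradient (fun x => truncPow p k (u x))
      (fun x => deriv (truncPow p k) (u x) • Ψ x) := fun k =>
    h.chain_rule hn (contDiff_truncPow hp k) (abs_deriv_truncPow_le_nat hp k)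
  have hVc : Continuous fun x : Sphere n => V x := hV.smooth.continuous.comp continuous_subtype_val
  have l1 : Tendsto (fun k => ∫ x, inner ℝ (deriv (truncPow p k) (u x) • Ψ x) (V x)
      ∂(surfaceMeasure n)) atTop (𝓝 (∫ x, inner ℝ ((p * |u x| ^ (p - 2) * u x) • Ψ x) (V x)
      ∂(surfaceMeasure n))) := by
    refine tendsto_integral_of_dominated_convergence
      (fun x => p * (|u x| ^ (p - 1) * ‖Ψ x‖) * ‖V x‖)
      (fun k => (hk k).integrable_grad.1.inner hVc.aestronglyMeasurable)
      (integrable_mul_continuous_sphere (hΨ.const_mul p) hVc.norm)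
      (fun k => Eventually.of_forall fun x => ?_) (Eventually.of_forall fun x => ?_)
    · refine (norm_inner_le_norm _ _).trans ?_
      rw [norm_smul, ← mul_assoc]
      gcongr
      exact abs_deriv_truncPow_le hp k _
    · obtain ⟨N, hN⟩ := exists_nat_ge |u x|
      refine tendsto_const_nhds.congr' ?_
      filter_upwards [eventually_ge_atTop N] with k hkN
      rw [deriv_truncPow_of_abs_le hp (hN.trans (by exact_mod_cast hkN))]
  have l2 : Tendsto (fun k => ∫ x, truncPow p k (u x) * surfaceDiv V x ∂(surfaceMeasure n)) atTop
      (𝓝 (∫ x, |u x| ^ p * surfaceDiv V x ∂(surfaceMeasure n))) := by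
    have hd := continuous_surfaceDiv hV
    refine tendsto_integral_of_dominated_convergence
      (fun x => p * |u x| ^ p * ‖surfaceDiv V x‖)
      (fun k => (hk k).integrable_fun.1.mul hd.aestronglyMeasurable)
      (integrable_mul_continuous_sphere (hu.const_mul p) hd.norm)
      (fun k => Eventually.of_forall fun x => ?_) (Eventually.of_forall fun x => ?_)
    · rw [norm_mul]
      gcongr
      exact abs_truncPow_le hp k _
    · obtain ⟨N, hN⟩ := exists_nat_ge |u x|
      refine tendsto_const_nhds.congr' ?_
      filter_upwards [eventually_ge_atTop N] with k hkN
      rw [truncPow_of_abs_le hp (hN.trans (by exact_mod_cast hkN))]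
  exact tendsto_nhds_unique l1 (l2.neg.congr fun k => ((hk k).integral_eq V hV).symm)

end Power

/-! ### Integration by parts against zonal fields. -/

section ZonalFields

/-- The cosine of the geodesic distance from `Φ`. -/
def height (Φ x : Sphere n) : ℝ := inner ℝ (x : Space n) (Φ : Space n)

theorem continuous_height (Φ : Sphere n) : Continuous (height Φ) :=
  continuous_subtype_val.inner continuous_const

theorem abs_height_le_one (Φ x : Sphere n) : |height Φ x| ≤ 1 := by
  have := abs_real_inner_le_norm (x : Space n) (Φ : Space n)
  rwa [norm_coe_sphere, norm_coe_sphere, mul_one] at this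

theorem height_mem_Icc (Φ x : Sphere n) : height Φ x ∈ Icc (-1 : ℝ) 1 :=
  abs_le.1 (abs_height_le_one Φ x)

/-- A tangent vector sees only the projection of Φ onto x^⊥, whose length is the sine of the
geodesic distance. -/
theorem abs_inner_le_of_tangent (Φ x : Sphere n) {v : Space n} (hv : inner ℝ v (x : Space n) = 0) :
    |inner ℝ v (Φ : Space n)| ≤ ‖v‖ * √(1 - height Φ x ^ 2) := by
  have h1 : inner ℝ v (Φ : Space n) = inner ℝ v ((Φ : Space n) - height Φ x • (x : Space n)) := by
    rw [inner_sub_right, inner_smul_right, hv]; ring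
  have h2 : ‖(Φ : Space n) - height Φ x • (x : Space n)‖ = √(1 - height Φ x ^ 2) := by
    rw [← Real.sqrt_sq (norm_nonneg _), norm_sub_sq_real, norm_smul, inner_smul_right,
      norm_coe_sphere, norm_coe_sphere, real_inner_comm, Real.norm_eq_abs, mul_one, sq_abs]
    change √(1 ^ 2 - 2 * (height Φ x * height Φ x) + height Φ x ^ 2) = _
    congr 1; ring
  rw [h1, ← h2]
  exact abs_real_inner_le_norm _ _

/-- The test field is h(s)(Φ - s x), that is, h(s) times the surface gradient of s = x·Φ. -/
theorem IsWeakGradient.zonal_smooth {v : Sphere n → ℝ} {Ξ : Sphere n → Space n}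
    (hv : IsWeakGradient v Ξ) (Φ : Sphere n) {h : ℝ → ℝ} (hh : ContDiff ℝ ∞ h) :
    ∫ x, h (height Φ x) * inner ℝ (Ξ x) (Φ : Space n) ∂(surfaceMeasure n)
      = - ∫ x, v x * (deriv h (height Φ x) * (1 - height Φ x ^ 2)
        - ((n : ℝ) - 1) * (h (height Φ x) * height Φ x)) ∂(surfaceMeasure n) := by
  let V : Space n → Space n := fun y =>
    h (inner ℝ y (Φ : Space n)) • ((Φ : Space n) - inner ℝ y (Φ : Space n) • y)
  have hV : IsSmoothTangentField V := by
    refine ⟨?_, fun x => ?_⟩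
    · have h1 : ContDiff ℝ ∞ fun y : Space n => inner ℝ y (Φ : Space n) :=
        contDiff_id.inner ℝ contDiff_const
      exact (hh.comp h1).smul (contDiff_const.sub (h1.smul contDiff_id))
    · simp only [V]
      rw [inner_smul_left, inner_sub_left, inner_smul_left, inner_coe_self, real_inner_comm]
      simp
  have hdiv : ∀ x, surfaceDiv V x = deriv h (height Φ x) * (1 - height Φ x ^ 2)
        - ((n : ℝ) - 1) * (h (height Φ x) * height Φ x) := by
    intro x
    have h1 : HasFDerivAt (fun y : Space n => h (inner ℝ y (Φ : Space n)))
        (deriv h (height Φ x) • innerSL ℝ (Φ : Space n)) x :=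
      (hh.differentiable (by simp) (height Φ x)).hasDerivAt.comp_hasFDerivAt (x : Space n)
        (hasFDerivAt_inner_left (Φ : Space n) x)
    rw [surfaceDiv_smul_tangent h1]
    have h2 : inner ℝ (Φ : Space n) (x : Space n) = height Φ x := real_inner_comm _ _
    simp only [smul_apply, innerSL_apply_apply, inner_sub_right, inner_smul_right, inner_coe_self,
      h2, smul_eq_mul]
    change deriv h (height Φ x) * (1 - height Φ x * height Φ x) - _ = _
    rw [sq]; rfl
  have := hv.integral_eq V hV
  simp only [hdiv] at this
  rw [← this]
  refine integral_congr_ae ?_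
  filter_upwards [hv.tangent] with x hx
  simp only [V]
  rw [inner_smul_right, inner_sub_right, inner_smul_right, hx, mul_zero, sub_zero]
  rfl

/-- Integration by parts against the zonal field with profile `h` of class `C¹`. -/
theorem IsWeakGradient.zonal {v : Sphere n → ℝ} {Ξ : Sphere n → Space n}
    (hv : IsWeakGradient v Ξ) (Φ : Sphere n) {h h' : ℝ → ℝ}
    (hh : ∀ s ∈ Icc (-1 : ℝ) 1, HasDerivAt h (h' s) s) (hh' : ContinuousOn h' (Icc (-1) 1)) :
    ∫ x, h (height Φ x) * inner ℝ (Ξ x) (Φ : Space n) ∂(surfaceMeasure n)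
      = - ∫ x, v x * (h' (height Φ x) * (1 - height Φ x ^ 2)
        - ((n : ℝ) - 1) * (h (height Φ x) * height Φ x)) ∂(surfaceMeasure n) := by
  have hhc : ContinuousOn h (Icc (-1) 1) := fun s hs => (hh s hs).continuousAt.continuousWithinAt
  -- The polynomial approximation is made at the level of h'. Antiderivatives agreeing with h at 0
  -- are then smooth on all of ℝ and uniformly close to h on [-1, 1], with the same error bound.
  choose P hP using fun k : ℕ => exists_polynomial_near_of_continuousOn (-1) 1 h' hh'
    (1 / ((k : ℝ) + 1)) (by positivity)
  let H : ℕ → ℝ → ℝ := fun k s => h 0 + ∫ t in (0 : ℝ)..s, (P k).eval t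
  have hHd : ∀ k s, HasDerivAt (H k) ((P k).eval s) s := fun k s =>
    ((P k).continuous.integral_hasStrictDerivAt 0 s).hasDerivAt.const_add _
  have hHs : ∀ k, ContDiff ℝ ∞ (H k) := by
    intro k
    rw [contDiff_infty_iff_deriv]
    refine ⟨fun s => (hHd k s).differentiableAt, ?_⟩
    rw [funext fun s => (hHd k s).deriv]
    simpa [Polynomial.coe_aeval_eq_eval] using (P k).contDiff_aeval (𝕜 := ℝ) ∞
  have hHh : ∀ k, ∀ s ∈ Icc (-1 : ℝ) 1, |H k s - h s| ≤ 1 / ((k : ℝ) + 1) := by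
    intro k s hs
    have h1 := (convex_Icc (-1 : ℝ) 1).norm_image_sub_le_of_norm_hasDerivWithin_le
      (f := fun s => H k s - h s) (f' := fun s => (P k).eval s - h' s)
      (C := 1 / ((k : ℝ) + 1)) (x := 0) (y := s)
      (fun t ht => ((hHd k t).sub (hh t ht)).hasDerivWithinAt)
      (fun t ht => (hP k t ht).le) (by simp) hs
    simp only [H, intervalIntegral.integral_same, add_zero, sub_self, sub_zero,
      Real.norm_eq_abs] at h1
    refine h1.trans (mul_le_of_le_one_right (by positivity) (abs_le.2 hs))
  have hone : ∀ k : ℕ, 1 / ((k : ℝ) + 1) ≤ 1 := fun k => by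
    rw [div_le_one (by positivity)]; linarith [(Nat.cast_nonneg k : (0 : ℝ) ≤ k)]
  obtain ⟨C, hC⟩ := isCompact_Icc.exists_bound_of_continuousOn hhc
  obtain ⟨D, hD⟩ := isCompact_Icc.exists_bound_of_continuousOn hh'
  have hHlim : ∀ s ∈ Icc (-1 : ℝ) 1, Tendsto (fun k => H k s) atTop (𝓝 (h s)) := by
    intro s hs
    rw [tendsto_iff_norm_sub_tendsto_zero]
    exact squeeze_zero (fun _ => norm_nonneg _) (fun k => hHh k s hs)
      tendsto_one_div_add_atTop_nhds_zero_nat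
  have hPlim : ∀ s ∈ Icc (-1 : ℝ) 1, Tendsto (fun k => (P k).eval s) atTop (𝓝 (h' s)) := by
    intro s hs
    rw [tendsto_iff_norm_sub_tendsto_zero]
    exact squeeze_zero (fun _ => norm_nonneg _) (fun k => (hP k s hs).le)
      tendsto_one_div_add_atTop_nhds_zero_nat
  have hHb : ∀ k, ∀ s ∈ Icc (-1 : ℝ) 1, |H k s| ≤ C + 1 := by
    intro k s hs
    have h1 := hC s hs
    rw [Real.norm_eq_abs] at h1
    linarith [abs_sub_abs_le_abs_sub (H k s) (h s), hHh k s hs, hone k]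
  have hPb : ∀ k, ∀ s ∈ Icc (-1 : ℝ) 1, |(P k).eval s| ≤ D + 1 := by
    intro k s hs
    have h1 := hD s hs
    rw [Real.norm_eq_abs] at h1
    linarith [abs_sub_abs_le_abs_sub ((P k).eval s) (h' s), hP k s hs, hone k]
  have hcH : ∀ k, Continuous fun x => H k (height Φ x) := fun k =>
    (hHs k).continuous.comp (continuous_height Φ)
  have hcP : ∀ k, Continuous fun x => (P k).eval (height Φ x) := fun k =>
    (P k).continuous.comp (continuous_height Φ)
  have hch := continuous_height Φ
  have hid := fun k => hv.zonal_smooth Φ (hHs k)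
  simp only [(hHd _ _).deriv] at hid
  have hiΦ := hv.integrable_inner (Φ : Space n)
  have l1 : Tendsto (fun k => ∫ x, H k (height Φ x) * inner ℝ (Ξ x) (Φ : Space n)
      ∂(surfaceMeasure n)) atTop
      (𝓝 (∫ x, h (height Φ x) * inner ℝ (Ξ x) (Φ : Space n) ∂(surfaceMeasure n))) := by
    refine tendsto_integral_of_dominated_convergence
      (fun x => (C + 1) * |inner ℝ (Ξ x) (Φ : Space n)|)
      (fun k => (hcH k).aestronglyMeasurable.mul hiΦ.1) (hiΦ.abs.const_mul _)
      (fun k => Eventually.of_forall fun x => ?_)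
      (Eventually.of_forall fun x => (hHlim _ (height_mem_Icc Φ x)).mul_const _)
    rw [norm_mul]
    exact mul_le_mul_of_nonneg_right (hHb k _ (height_mem_Icc Φ x)) (abs_nonneg _)
  have l2 : Tendsto (fun k => ∫ x, v x * ((P k).eval (height Φ x) * (1 - height Φ x ^ 2)
        - ((n : ℝ) - 1) * (H k (height Φ x) * height Φ x)) ∂(surfaceMeasure n)) atTop
      (𝓝 (∫ x, v x * (h' (height Φ x) * (1 - height Φ x ^ 2)
        - ((n : ℝ) - 1) * (h (height Φ x) * height Φ x)) ∂(surfaceMeasure n))) := by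
    refine tendsto_integral_of_dominated_convergence
      (fun x => |v x| * ((D + 1) * 1 + |(n : ℝ) - 1| * ((C + 1) * 1)))
      (fun k => ?_) (hv.integrable_fun.abs.mul_const _)
      (fun k => Eventually.of_forall fun x => ?_) (Eventually.of_forall fun x => ?_)
    · have hcP' := hcP k
      have hcH' := hcH k
      exact hv.integrable_fun.1.mul (by fun_prop : Continuous fun x =>
        (P k).eval (height Φ x) * (1 - height Φ x ^ 2)
          - ((n : ℝ) - 1) * (H k (height Φ x) * height Φ x)).aestronglyMeasurable
    · have hs := height_mem_Icc Φ x
      have h1 : |1 - height Φ x ^ 2| ≤ 1 := by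
        rw [abs_le]; constructor <;> nlinarith [hs.1, hs.2, sq_nonneg (height Φ x)]
      have hD0 : 0 ≤ D + 1 := (abs_nonneg _).trans (hPb k _ hs)
      have hC0 : 0 ≤ C + 1 := (abs_nonneg _).trans (hHb k _ hs)
      rw [norm_mul, Real.norm_eq_abs, Real.norm_eq_abs]
      refine mul_le_mul_of_nonneg_left ((abs_sub _ _).trans (add_le_add ?_ ?_)) (abs_nonneg _)
      · rw [abs_mul]
        exact mul_le_mul (hPb k _ hs) h1 (abs_nonneg _) hD0
      · rw [abs_mul, abs_mul]
        exact mul_le_mul_of_nonneg_left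
          (mul_le_mul (hHb k _ hs) (abs_height_le_one Φ x) (abs_nonneg _) hC0) (abs_nonneg _)
    · have hs := height_mem_Icc Φ x
      exact (((hPlim _ hs).mul_const _).sub (((hHlim _ hs).mul_const _).const_mul _)).const_mul _
  exact tendsto_nhds_unique l1 (l2.neg.congr fun k => (hid k).symm)

end ZonalFields

/-! ### Young's inequality in the form with sharp constants. -/

section Young

theorem young_rpow {p a b : ℝ} (hp : 1 < p) (ha : 0 ≤ a) (hb : 0 ≤ b) :
    p * a ^ (p - 1) * b ≤ (p - 1) * a ^ p + b ^ p := by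
  have hp0 : 0 < p := by linarith
  have hp1 : p - 1 ≠ 0 := by linarith
  have h := Real.young_inequality_of_nonneg (Real.rpow_nonneg ha (p - 1)) hb
    (Real.HolderConjugate.conjExponent hp).symm
  have h1 : (a ^ (p - 1)) ^ p.conjExponent = a ^ p := by
    rw [← Real.rpow_mul ha, Real.conjExponent]
    congr 1; field_simp
  rw [h1, Real.conjExponent] at h
  have h2 := mul_le_mul_of_nonneg_left h hp0.le
  calc p * a ^ (p - 1) * b = p * (a ^ (p - 1) * b) := by ring
    _ ≤ _ := h2
    _ = _ := by field_simp

theorem rpow_sub_one_mul_le {p a b : ℝ} (hp : 1 < p) (ha : 0 ≤ a) (hb : 0 ≤ b) :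
    a ^ (p - 1) * b ≤ a ^ p + b ^ p := by
  have h := young_rpow hp ha hb
  have h1 := Real.rpow_nonneg ha p
  have h2 := Real.rpow_nonneg hb p
  have h3 := mul_nonneg (Real.rpow_nonneg ha (p - 1)) hb
  nlinarith

end Young

/-! ### Integrability of a limit from bounded integrals. -/

section Integrability

/-- Fatou's lemma, used to pass uniform bounds on the regularized weights to the singular weight. -/
theorem integrable_of_tendsto_of_integral_le {X : Type*} [MeasurableSpace X] {ν : Measure X}
    {F : ℕ → X → ℝ} {f : X → ℝ} {C : ℝ} (hF : ∀ i, Integrable (F i) ν)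
    (hF0 : ∀ i x, 0 ≤ F i x) (hlim : ∀ᵐ x ∂ν, Tendsto (fun i => F i x) atTop (𝓝 (f x)))
    (hC : ∀ i, ∫ x, F i x ∂ν ≤ C) : Integrable f ν := by
  refine ⟨aestronglyMeasurable_of_tendsto_ae atTop (fun i => (hF i).1) hlim, ?_⟩
  have hfatou : ∫⁻ x, ‖f x‖ₑ ∂ν ≤ liminf (fun i => ∫⁻ x, ‖F i x‖ₑ ∂ν) atTop := by
    refine le_of_eq_of_le (lintegral_congr_ae ?_)
      (lintegral_liminf_le' fun i => (hF i).1.enorm)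
    filter_upwards [hlim] with x hx using hx.enorm.liminf_eq.symm
  refine hfatou.trans_lt ?_
  have : ∀ i, ∫⁻ x, ‖F i x‖ₑ ∂ν ≤ ENNReal.ofReal C := by
    intro i
    have h1 : ∫⁻ x, ‖F i x‖ₑ ∂ν = ENNReal.ofReal (∫ x, F i x ∂ν) := by
      rw [ofReal_integral_eq_lintegral_ofReal (hF i) (Eventually.of_forall (hF0 i))]
      exact lintegral_congr fun x => Real.enorm_of_nonneg (hF0 i x)
    rw [h1]
    exact ENNReal.ofReal_le_ofReal (hC i)
  refine lt_of_le_of_lt ?_ (ENNReal.ofReal_lt_top (r := C))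
  refine (liminf_le_liminf (Eventually.of_forall this)).trans ?_
  simp

end Integrability

/-! ### The equator and the poles are null sets. -/

section NullSets

/-- The surface measure of a set is a multiple of the volume of the cone over it, and the cone over
a subset of S stays in S, which has volume zero. -/
theorem ae_notMem_submodule {S : Submodule ℝ (Space n)} (hS : S ≠ ⊤) :
    ∀ᵐ (x : Sphere n) ∂(surfaceMeasure n), (x : Space n) ∉ S := by
  have hm : MeasurableSet {x : Sphere n | (x : Space n) ∈ S} :=
    (S.closed_of_finiteDimensional.preimage continuous_subtype_val).measurableSet
  have hS0 := Measure.addHaar_submodule (volume : Measure (Space n)) S hS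
  rw [ae_iff]
  simp only [not_not]
  rw [surfaceMeasure, Measure.toSphere_apply' _ hm]
  refine mul_eq_zero_of_right _ (measure_mono_null ?_ hS0)
  rintro _ ⟨r, _, _, ⟨x, hx, rfl⟩, rfl⟩
  exact S.smul_mem r hx

theorem ae_height_ne_zero (Φ : Sphere n) : ∀ᵐ x ∂(surfaceMeasure n), height Φ x ≠ 0 := by
  have hS : LinearMap.ker ((innerSL ℝ (Φ : Space n)).toLinearMap) ≠ ⊤ := by
    intro h
    have h1 : (Φ : Space n) ∈ LinearMap.ker ((innerSL ℝ (Φ : Space n)).toLinearMap) := by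
      rw [h]; trivial
    have h2 : inner ℝ (Φ : Space n) (Φ : Space n) = 0 := h1
    rw [inner_coe_self] at h2
    exact one_ne_zero h2
  filter_upwards [ae_notMem_submodule hS] with x hx h0
  apply hx
  rw [height, real_inner_comm] at h0
  exact h0

/-- Equality in Cauchy–Schwarz puts x on the line ℝΦ, a proper subspace as n ≥ 2. -/
theorem ae_height_sq_lt_one (hn : 2 ≤ n) (Φ : Sphere n) :
    ∀ᵐ x ∂(surfaceMeasure n), height Φ x ^ 2 < 1 := by
  have hS : Submodule.span ℝ {(Φ : Space n)} ≠ ⊤ := by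
    intro h
    have h1 := finrank_span_singleton (K := ℝ) (v := (Φ : Space n))
      (by rw [← norm_ne_zero_iff, norm_coe_sphere]; exact one_ne_zero)
    rw [h, finrank_top, finrank_euclideanSpace_fin] at h1
    omega
  filter_upwards [ae_notMem_submodule hS] with x hx
  by_contra h
  apply hx
  have h1 : height Φ x ^ 2 = 1 :=
    le_antisymm ((sq_le_one_iff_abs_le_one _).2 (abs_height_le_one Φ x)) (not_lt.1 h)
  have h2 : ‖(x : Space n) - height Φ x • (Φ : Space n)‖ ^ 2 = 0 := by
    rw [norm_sub_sq_real, norm_smul, inner_smul_right, norm_coe_sphere, norm_coe_sphere,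
      Real.norm_eq_abs, mul_one, sq_abs]
    change 1 ^ 2 - 2 * (height Φ x * height Φ x) + height Φ x ^ 2 = 0
    nlinarith
  have h3 : (x : Space n) = height Φ x • (Φ : Space n) :=
    sub_eq_zero.1 (norm_eq_zero.1 (pow_eq_zero_iff two_ne_zero |>.1 h2))
  rw [h3]
  exact Submodule.smul_mem _ _ (Submodule.mem_span_singleton_self _)

end NullSets

/-! ### The Hardy inequality with regularized weight. -/

section RegularizedHardy

/-- The regularization `(1 - s² + δ) ^ (-p / 2)` of `sin ^ (-p)`, where `s` is the cosine. -/
def regWeight (p δ s : ℝ) : ℝ := (1 - s ^ 2 + δ) ^ (-(p / 2))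

theorem one_sub_sq_nonneg {s : ℝ} (hs : s ∈ Icc (-1 : ℝ) 1) : 0 ≤ 1 - s ^ 2 := by
  nlinarith [hs.1, hs.2]

theorem regWeight_pos {p δ s : ℝ} (hδ : 0 < δ) (hs : s ∈ Icc (-1 : ℝ) 1) :
    0 < regWeight p δ s :=
  Real.rpow_pos_of_pos (by linarith [one_sub_sq_nonneg hs]) _

theorem hasDerivAt_regWeight {p δ s : ℝ} (hδ : 0 < δ) (hs : s ∈ Icc (-1 : ℝ) 1) :
    HasDerivAt (regWeight p δ) (p * s * (regWeight p δ s / (1 - s ^ 2 + δ))) s := by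
  have hq : 0 < 1 - s ^ 2 + δ := by linarith [one_sub_sq_nonneg hs]
  have h1 : HasDerivAt (fun s : ℝ => 1 - s ^ 2 + δ) (-(2 * s)) s := by
    simpa using ((hasDerivAt_pow 2 s).const_sub 1).add_const δ
  have h2 := h1.rpow_const (p := -(p / 2)) (Or.inl hq.ne')
  rw [Real.rpow_sub_one hq.ne'] at h2
  convert! h2 using 1
  simp only [regWeight]
  ring

theorem continuousOn_regWeight {p δ : ℝ} (hδ : 0 < δ) :
    ContinuousOn (regWeight p δ) (Icc (-1) 1) :=
  fun _ hs => (hasDerivAt_regWeight hδ hs).continuousAt.continuousWithinAt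

theorem continuous_comp_height {f : ℝ → ℝ} (hf : ContinuousOn f (Icc (-1) 1)) (Φ : Sphere n) :
    Continuous fun x => f (height Φ x) :=
  hf.comp_continuous (continuous_height Φ) (height_mem_Icc Φ)

theorem MemLp.integrable_rpow {F : Type*} [NormedAddCommGroup F] {f : Sphere n → F} {p : ℝ}
    (hp : 0 < p) (hf : MemLp f (ENNReal.ofReal p) (surfaceMeasure n)) :
    Integrable (fun x => ‖f x‖ ^ p) (surfaceMeasure n) := by
  simpa [ENNReal.toReal_ofReal hp.le] using hf.integrable_norm_rpow'

/-- The Hardy inequality with regularized weight. The function `k` is the profile of the zonal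
field used in the integration by parts. -/
theorem hardy_regularized (hn : 2 ≤ n) (Φ : Sphere n) {p : ℝ} (hp : 1 < p)
    (hpn : p < (n : ℝ) - 1) {u : Sphere n → ℝ} {Ψ : Sphere n → Space n}
    (h : IsWeakGradient u Ψ) (hu : Integrable (fun x => |u x| ^ p) (surfaceMeasure n))
    (hΨ : Integrable (fun x => ‖Ψ x‖ ^ p) (surfaceMeasure n))
    {k k' A B L : ℝ → ℝ} (hk : ∀ s ∈ Icc (-1 : ℝ) 1, HasDerivAt k (k' s) s)
    (hk' : ContinuousOn k' (Icc (-1) 1)) (hA : Continuous A) (hB : Continuous B)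
    (hL : Continuous L) (hA0 : ∀ s, 0 ≤ A s) (hB0 : ∀ s, 0 ≤ B s)
    (hkAB : ∀ s ∈ Icc (-1 : ℝ) 1, |k s| ≤ A s ^ (p - 1) * B s)
    (hsk : ∀ s ∈ Icc (-1 : ℝ) 1, 0 ≤ s * k s)
    (hkL : ∀ s ∈ Icc (-1 : ℝ) 1, ((n : ℝ) - p - 1) * A s ^ p - L s * (1 - s ^ 2)
      ≤ ((n : ℝ) - p - 1) * (s * k s) - k' s * (1 - s ^ 2)) {δ : ℝ} (hδ : 0 < δ) :
    alpha n p ^ p * ∫ x, |u x| ^ p * (A (height Φ x) ^ p * regWeight p δ (height Φ x))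
        ∂(surfaceMeasure n)
      ≤ (∫ x, ‖Ψ x‖ ^ p * B (height Φ x) ^ p ∂(surfaceMeasure n))
        + alpha n p ^ (p - 1) * ∫ x, |u x| ^ p * (L (height Φ x) *
          ((1 - height Φ x ^ 2) * regWeight p δ (height Φ x))) ∂(surfaceMeasure n) := by
  have hp0 : 0 < p := by linarith
  have hα : 0 < alpha n p := div_pos (by linarith) hp0
  have hpα : p * alpha n p = (n : ℝ) - p - 1 := by
    rw [alpha]; field_simp
  set α := alpha n p with hαdef
  set c := α ^ (p - 1) with hc
  have hc0 : 0 < c := Real.rpow_pos_of_pos hα _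
  have hcα : c * α = α ^ p := by
    rw [hc, ← Real.rpow_add_one hα.ne']; congr 1; ring
  have hΨm : Integrable (fun x => |u x| ^ (p - 1) * ‖Ψ x‖) (surfaceMeasure n) := by
    refine (hu.add hΨ).mono' ?_ (Eventually.of_forall fun x => ?_)
    · exact (((Real.continuous_rpow_const (by linarith)).comp
        continuous_abs).comp_aestronglyMeasurable h.integrable_fun.1).mul h.integrable_grad.1.norm
    · rw [Real.norm_of_nonneg (by positivity)]
      exact rpow_sub_one_mul_le hp (abs_nonneg _) (norm_nonneg _)
  have hv := h.abs_rpow hn hp hu hΨm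
  let w := regWeight p δ
  have hwc : ContinuousOn w (Icc (-1) 1) := continuousOn_regWeight hδ
  have hkc : ContinuousOn k (Icc (-1) 1) := fun s hs => (hk s hs).continuousAt.continuousWithinAt
  -- The factor c = α^(p-1) is the one for which Young's inequality below, with αA|u| as first
  -- factor, has the sharp constant. The minus sign makes the leading part of the divergence
  -- nonnegative.
  let f : ℝ → ℝ := fun s => -c * (k s * w s)
  let f' : ℝ → ℝ := fun s => -c * (k' s * w s + k s * (p * s * (w s / (1 - s ^ 2 + δ))))
  have hq : ∀ s ∈ Icc (-1 : ℝ) 1, 0 < 1 - s ^ 2 + δ := fun s hs => by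
    linarith [one_sub_sq_nonneg hs]
  have hf : ∀ s ∈ Icc (-1 : ℝ) 1, HasDerivAt f (f' s) s := fun s hs =>
    ((hk s hs).mul (hasDerivAt_regWeight hδ hs)).const_mul (-c)
  have hfc' : ContinuousOn f' (Icc (-1) 1) := by
    have h1 : ContinuousOn (fun s : ℝ => 1 - s ^ 2 + δ) (Icc (-1) 1) := by fun_prop
    exact continuousOn_const.mul ((hk'.mul hwc).add (hkc.mul
      ((continuousOn_const.mul continuousOn_id).mul (hwc.div h1 fun s hs => (hq s hs).ne'))))
  have hfc : ContinuousOn f (Icc (-1) 1) := continuousOn_const.mul (hkc.mul hwc)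
  have hid := hv.zonal Φ hf hfc'
  let D : ℝ → ℝ := fun s => f' s * (1 - s ^ 2) - ((n : ℝ) - 1) * (f s * s)
  have hDc : ContinuousOn D (Icc (-1) 1) := by
    have h1 : ContinuousOn (fun s : ℝ => 1 - s ^ 2) (Icc (-1) 1) := by fun_prop
    exact (hfc'.mul h1).sub (continuousOn_const.mul (hfc.mul continuousOn_id))
  have hApc : Continuous fun s => A s ^ p := hA.rpow_const fun s => Or.inr hp0.le
  have hBpc : Continuous fun s => B s ^ p := hB.rpow_const fun s => Or.inr hp0.le
  have i1 : Integrable (fun x => |u x| ^ p * (A (height Φ x) ^ p * w (height Φ x)))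
      (surfaceMeasure n) :=
    integrable_mul_continuous_sphere hu (continuous_comp_height (hApc.continuousOn.mul hwc) Φ)
  have i2 : Integrable (fun x => ‖Ψ x‖ ^ p * B (height Φ x) ^ p) (surfaceMeasure n) :=
    integrable_mul_continuous_sphere hΨ (continuous_comp_height hBpc.continuousOn Φ)
  have i3 : Integrable (fun x => |u x| ^ p * (L (height Φ x) *
      ((1 - height Φ x ^ 2) * w (height Φ x)))) (surfaceMeasure n) := by
    have h1 : ContinuousOn (fun s : ℝ => L s * ((1 - s ^ 2) * w s)) (Icc (-1) 1) :=
      hL.continuousOn.mul (ContinuousOn.mul (by fun_prop) hwc)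
    exact integrable_mul_continuous_sphere hu (continuous_comp_height h1 Φ)
  have i4 : Integrable (fun x => |u x| ^ p * D (height Φ x)) (surfaceMeasure n) :=
    integrable_mul_continuous_sphere hu (continuous_comp_height hDc Φ)
  have i5 : Integrable (fun x => f (height Φ x) *
      inner ℝ ((p * |u x| ^ (p - 2) * u x) • Ψ x) (Φ : Space n)) (surfaceMeasure n) :=
    (integrable_mul_continuous_sphere (hv.integrable_inner (Φ : Space n))
      (continuous_comp_height hfc Φ)).congr (Eventually.of_forall fun x => mul_comm _ _)
  have hDle : ∀ s ∈ Icc (-1 : ℝ) 1,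
      p * α ^ p * (A s ^ p * w s) - c * (L s * ((1 - s ^ 2) * w s)) ≤ D s := by
    intro s hs
    have hw : 0 < w s := regWeight_pos hδ hs
    have hr : (1 - s ^ 2) / (1 - s ^ 2 + δ) ≤ 1 := (div_le_one (hq s hs)).2 (by linarith)
    have h1 : D s = c * w s * (((n : ℝ) - 1) * (s * k s) - k' s * (1 - s ^ 2)
        - p * (s * k s) * ((1 - s ^ 2) / (1 - s ^ 2 + δ))) := by
      simp only [D, f, f']; ring
    -- The sign condition s k ≥ 0 enters here: the loss caused by δ has the favourable direction,
    -- and n - 1 drops to n - 1 - p.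
    have h2 : p * (s * k s) * ((1 - s ^ 2) / (1 - s ^ 2 + δ)) ≤ p * (s * k s) :=
      mul_le_of_le_one_right (mul_nonneg hp0.le (hsk s hs)) hr
    have h3 : p * α * A s ^ p - L s * (1 - s ^ 2) ≤ ((n : ℝ) - 1) * (s * k s)
        - k' s * (1 - s ^ 2) - p * (s * k s) * ((1 - s ^ 2) / (1 - s ^ 2 + δ)) := by
      have := hkL s hs
      rw [hpα]
      linarith
    rw [h1, ← hcα]
    calc _ = c * w s * (p * α * A s ^ p - L s * (1 - s ^ 2)) := by ring
      _ ≤ _ := mul_le_mul_of_nonneg_left h3 (by positivity)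
  have hFle : ∀ᵐ x ∂(surfaceMeasure n), -(f (height Φ x) *
      inner ℝ ((p * |u x| ^ (p - 2) * u x) • Ψ x) (Φ : Space n))
      ≤ (p - 1) * α ^ p * (|u x| ^ p * (A (height Φ x) ^ p * w (height Φ x)))
        + ‖Ψ x‖ ^ p * B (height Φ x) ^ p := by
    filter_upwards [h.tangent] with x hx
    set s := height Φ x with hsdef
    have hs : s ∈ Icc (-1 : ℝ) 1 := height_mem_Icc Φ x
    have hqs := hq s hs
    set q := 1 - s ^ 2 + δ with hqdef
    -- m is the regularized 1/sin d: w = m^p, and the factor √(1 - s²) ≤ m⁻¹ from the tangential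
    -- part of Φ lowers the exponent to p - 1, as Young's inequality requires.
    set m := q ^ (-(1 / 2) : ℝ) with hm
    have hm0 : 0 < m := Real.rpow_pos_of_pos hqs _
    have hwm : w s = m ^ p := by
      rw [hm, ← Real.rpow_mul hqs.le]
      change q ^ (-(p / 2)) = _
      congr 1; ring
    have hsq : w s * √(1 - s ^ 2) ≤ m ^ (p - 1) := by
      have h1 : √(1 - s ^ 2) ≤ m⁻¹ := by
        rw [hm, Real.rpow_neg hqs.le, inv_inv, ← Real.sqrt_eq_rpow]
        exact Real.sqrt_le_sqrt (by linarith)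
      calc w s * √(1 - s ^ 2) ≤ m ^ p * m⁻¹ := by
            rw [hwm]; exact mul_le_mul_of_nonneg_left h1 (by positivity)
        _ = m ^ (p - 1) := by rw [Real.rpow_sub_one hm0.ne']; rfl
    have hw0 : 0 < w s := regWeight_pos hδ hs
    have hin := abs_inner_le_of_tangent Φ x hx
    have hup := abs_deriv_abs_rpow hp (u x)
    calc _ ≤ |f s * inner ℝ ((p * |u x| ^ (p - 2) * u x) • Ψ x) (Φ : Space n)| := neg_le_abs _
      _ = (c * |k s| * w s) * ((p * |u x| ^ (p - 1)) * |inner ℝ (Ψ x) (Φ : Space n)|) := by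
          rw [inner_smul_left, RCLike.conj_to_real, abs_mul, abs_mul _ (inner ℝ (Ψ x) _), hup]
          simp only [f]
          rw [abs_mul, abs_mul, abs_neg, abs_of_pos hc0, abs_of_pos hw0]
          ring
      _ ≤ (c * (A s ^ (p - 1) * B s) * w s) * ((p * |u x| ^ (p - 1)) *
          (‖Ψ x‖ * √(1 - s ^ 2))) := by
          have := hkAB s hs
          have hA0' := hA0 s
          have hB0' := hB0 s
          gcongr
      _ = (c * (A s ^ (p - 1) * B s)) * ((p * |u x| ^ (p - 1)) * ‖Ψ x‖)
          * (w s * √(1 - s ^ 2)) := by ring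
      _ ≤ (c * (A s ^ (p - 1) * B s)) * ((p * |u x| ^ (p - 1)) * ‖Ψ x‖) * m ^ (p - 1) := by
          have hA0' := hA0 s
          have hB0' := hB0 s
          exact mul_le_mul_of_nonneg_left hsq (by positivity)
      _ = p * (α * A s * |u x| * m) ^ (p - 1) * (‖Ψ x‖ * B s) := by
          rw [Real.mul_rpow (mul_nonneg (mul_nonneg hα.le (hA0 s)) (abs_nonneg _)) hm0.le,
            Real.mul_rpow (mul_nonneg hα.le (hA0 s)) (abs_nonneg _),
            Real.mul_rpow hα.le (hA0 s)]
          ring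
      _ ≤ (p - 1) * (α * A s * |u x| * m) ^ p + (‖Ψ x‖ * B s) ^ p :=
          young_rpow hp (mul_nonneg (mul_nonneg (mul_nonneg hα.le (hA0 s)) (abs_nonneg _)) hm0.le)
            (mul_nonneg (norm_nonneg _) (hB0 s))
      _ = _ := by
          rw [Real.mul_rpow (mul_nonneg (mul_nonneg hα.le (hA0 s)) (abs_nonneg _)) hm0.le,
            Real.mul_rpow (mul_nonneg hα.le (hA0 s)) (abs_nonneg _),
            Real.mul_rpow hα.le (hA0 s), Real.mul_rpow (norm_nonneg _) (hB0 s), hwm]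
          ring
  have e1 : ∫ x, |u x| ^ p * D (height Φ x) ∂(surfaceMeasure n)
      ≤ (p - 1) * α ^ p * (∫ x, |u x| ^ p * (A (height Φ x) ^ p * w (height Φ x))
          ∂(surfaceMeasure n)) + ∫ x, ‖Ψ x‖ ^ p * B (height Φ x) ^ p ∂(surfaceMeasure n) := by
    rw [← neg_eq_iff_eq_neg] at hid
    rw [← hid, ← integral_neg, ← integral_const_mul, ← integral_add (i1.const_mul _) i2]
    exact integral_mono_ae i5.neg ((i1.const_mul _).add i2) hFle
  have e2 : p * α ^ p * (∫ x, |u x| ^ p * (A (height Φ x) ^ p * w (height Φ x))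
      ∂(surfaceMeasure n)) - c * (∫ x, |u x| ^ p * (L (height Φ x) *
          ((1 - height Φ x ^ 2) * w (height Φ x))) ∂(surfaceMeasure n))
      ≤ ∫ x, |u x| ^ p * D (height Φ x) ∂(surfaceMeasure n) := by
    rw [← integral_const_mul, ← integral_const_mul,
      ← integral_sub (i1.const_mul _) (i3.const_mul _)]
    refine integral_mono ((i1.const_mul _).sub (i3.const_mul _)) i4 fun x => ?_
    have := mul_le_mul_of_nonneg_left (hDle _ (height_mem_Icc Φ x))
      (Real.rpow_nonneg (abs_nonneg (u x)) p)
    simp only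
    linarith
  -- pα^p from the divergence minus (p-1)α^p from Young's inequality leaves α^p.
  linarith

end RegularizedHardy

/-! ### Removing the regularization. -/

section Limit

theorem regWeight_le_zero {p δ s : ℝ} (hp : 0 < p) (hδ : 0 < δ) (hs : s ^ 2 < 1) :
    regWeight p δ s ≤ regWeight p 0 s :=
  Real.rpow_le_rpow_of_nonpos (by linarith) (by linarith) (by linarith)

theorem tendsto_regWeight {p s : ℝ} (hs : s ^ 2 < 1) :
    Tendsto (fun j : ℕ => regWeight p (1 / ((j : ℝ) + 1)) s) atTop (𝓝 (regWeight p 0 s)) := by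
  have h1 : Tendsto (fun j : ℕ => 1 - s ^ 2 + 1 / ((j : ℝ) + 1)) atTop (𝓝 (1 - s ^ 2 + 0)) :=
    tendsto_const_nhds.add tendsto_one_div_add_atTop_nhds_zero_nat
  exact h1.rpow_const (Or.inl (by rw [add_zero]; linarith))

/-- Away from the poles the weight increases as δ decreases, so the singular weight, assumed
integrable against v, dominates. -/
theorem tendsto_integral_regWeight (hn : 2 ≤ n) (Φ : Sphere n) {p : ℝ} (hp : 0 < p)
    {v : Sphere n → ℝ} (hv : Integrable v (surfaceMeasure n)) (hv0 : ∀ x, 0 ≤ v x)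
    (hw : Integrable (fun x => v x * regWeight p 0 (height Φ x)) (surfaceMeasure n))
    {f : ℝ → ℝ} (hf : ContinuousOn f (Icc (-1) 1)) :
    Tendsto (fun j : ℕ => ∫ x, v x * (f (height Φ x) * regWeight p (1 / ((j : ℝ) + 1))
      (height Φ x)) ∂(surfaceMeasure n)) atTop
      (𝓝 (∫ x, v x * (f (height Φ x) * regWeight p 0 (height Φ x)) ∂(surfaceMeasure n))) := by
  obtain ⟨C, hC⟩ := isCompact_Icc.exists_bound_of_continuousOn hf
  have hC0 : 0 ≤ C := (norm_nonneg _).trans (hC 0 (by simp))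
  refine tendsto_integral_of_dominated_convergence
    (fun x => C * (v x * regWeight p 0 (height Φ x))) (fun j => ?_) (hw.const_mul C)
    (fun j => ?_) ?_
  · have h1 : (0 : ℝ) < 1 / ((j : ℝ) + 1) := by positivity
    exact (integrable_mul_continuous_sphere hv
      (continuous_comp_height (hf.mul (continuousOn_regWeight h1)) Φ)).1
  · filter_upwards [ae_height_sq_lt_one hn Φ] with x hx
    have h1 : (0 : ℝ) < 1 / ((j : ℝ) + 1) := by positivity
    have h2 := regWeight_le_zero hp h1 hx
    have h3 := (regWeight_pos (p := p) h1 (height_mem_Icc Φ x)).le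
    rw [norm_mul, norm_mul, Real.norm_of_nonneg (hv0 x), Real.norm_of_nonneg h3]
    calc _ ≤ v x * (C * regWeight p 0 (height Φ x)) :=
          mul_le_mul_of_nonneg_left (mul_le_mul (hC _ (height_mem_Icc Φ x)) h2 h3 hC0) (hv0 x)
      _ = _ := by ring
  · filter_upwards [ae_height_sq_lt_one hn Φ] with x hx
    exact ((tendsto_regWeight hx).const_mul _).const_mul _

theorem integrable_mul_regWeight_zero (Φ : Sphere n) {p : ℝ}
    {v : Sphere n → ℝ}
    (hw : Integrable (fun x => v x * regWeight p 0 (height Φ x)) (surfaceMeasure n))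
    {f : ℝ → ℝ} (hf : ContinuousOn f (Icc (-1) 1)) :
    Integrable (fun x => v x * (f (height Φ x) * regWeight p 0 (height Φ x)))
      (surfaceMeasure n) := by
  refine (integrable_mul_continuous_sphere hw (continuous_comp_height hf Φ)).congr
    (Eventually.of_forall fun x => ?_)
  simp only
  ring

end Limit

/-! ### The sine and tangent inequalities in terms of the height. -/

section SineHardy

variable {p : ℝ} {u : Sphere n → ℝ} {Ψ : Sphere n → Space n}

/-- The profile k = s. The constant n - p in the lower-order term is n - p - 1, from replacing s² by
1 - (1 - s²), plus 1 from k' = 1. -/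
theorem sine_hardy_regularized (hn : 2 ≤ n) (Φ : Sphere n) (hp : 1 < p) (hpn : p < (n : ℝ) - 1)
    (h : IsWeakGradient u Ψ) (hu : Integrable (fun x => |u x| ^ p) (surfaceMeasure n))
    (hΨ : Integrable (fun x => ‖Ψ x‖ ^ p) (surfaceMeasure n)) {δ : ℝ} (hδ : 0 < δ) :
    alpha n p ^ p * ∫ x, |u x| ^ p * (1 * regWeight p δ (height Φ x)) ∂(surfaceMeasure n)
      ≤ (∫ x, ‖Ψ x‖ ^ p * |height Φ x| ^ p ∂(surfaceMeasure n))
        + alpha n p ^ (p - 1) * ∫ x, |u x| ^ p * (((n : ℝ) - p) *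
          ((1 - height Φ x ^ 2) * regWeight p δ (height Φ x))) ∂(surfaceMeasure n) := by
  have := hardy_regularized hn Φ hp hpn h hu hΨ (k := fun s => s) (k' := fun _ => 1)
    (A := fun _ => 1) (B := fun s => |s|) (L := fun _ => (n : ℝ) - p)
    (fun s _ => hasDerivAt_id s) continuousOn_const continuous_const continuous_abs
    continuous_const (fun _ => zero_le_one) (fun s => abs_nonneg s)
    (fun s _ => by simp) (fun s _ => mul_self_nonneg s)
    (fun s _ => by rw [Real.one_rpow]; apply le_of_eq; ring) hδ
  simpa only [Real.one_rpow] using this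

/-- The lower-order term of the regularized inequality is absorbed into half of the left side, up to
a multiple of ∫|u|^p independent of δ. This is an a priori bound on the regularized integrals, and
Fatou applies. -/
theorem integrable_regWeight_zero (hn : 2 ≤ n) (Φ : Sphere n) (hp : 1 < p)
    (hpn : p < (n : ℝ) - 1) (h : IsWeakGradient u Ψ)
    (hu : Integrable (fun x => |u x| ^ p) (surfaceMeasure n))
    (hΨ : Integrable (fun x => ‖Ψ x‖ ^ p) (surfaceMeasure n)) :
    Integrable (fun x => |u x| ^ p * regWeight p 0 (height Φ x)) (surfaceMeasure n) := by
  have hp0 : 0 < p := by linarith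
  have hα : 0 < alpha n p := div_pos (by linarith) hp0
  have ha : 0 < alpha n p ^ p := Real.rpow_pos_of_pos hα _
  have hc : 0 < alpha n p ^ (p - 1) := Real.rpow_pos_of_pos hα _
  have hnp : 0 < (n : ℝ) - p := by linarith
  -- η is the threshold for sin² d: below it the lower-order coefficient is at most α^p / 2; above
  -- it the weight is at most η^(-p/2), uniformly in δ.
  obtain ⟨η, hη, hηeq⟩ : ∃ η : ℝ, 0 < η ∧
      alpha n p ^ (p - 1) * ((n : ℝ) - p) * η = alpha n p ^ p / 2 :=
    ⟨alpha n p ^ p / 2 / (alpha n p ^ (p - 1) * ((n : ℝ) - p)), by positivity, by field_simp⟩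
  set b := alpha n p ^ (p - 1) * ((n : ℝ) - p) with hb
  have hb0 : 0 < b := by positivity
  set I := ∫ x, ‖Ψ x‖ ^ p * |height Φ x| ^ p ∂(surfaceMeasure n)
  set K := b * η ^ (-(p / 2)) with hK
  set N := ∫ x, |u x| ^ p ∂(surfaceMeasure n)
  have hδ : ∀ j : ℕ, (0 : ℝ) < 1 / ((j : ℝ) + 1) := fun j => by positivity
  have hint : ∀ j : ℕ, Integrable (fun x => |u x| ^ p *
      regWeight p (1 / ((j : ℝ) + 1)) (height Φ x)) (surfaceMeasure n) := fun j =>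
    integrable_mul_continuous_sphere hu (continuous_comp_height (continuousOn_regWeight (hδ j)) Φ)
  refine integrable_of_tendsto_of_integral_le (C := (I + K * N) / (alpha n p ^ p / 2)) hint
    (fun j x => mul_nonneg (Real.rpow_nonneg (abs_nonneg _) _)
      (regWeight_pos (hδ j) (height_mem_Icc Φ x)).le) ?_ fun j => ?_
  · filter_upwards [ae_height_sq_lt_one hn Φ] with x hx
    exact (tendsto_regWeight hx).const_mul _
  have hreg := sine_hardy_regularized hn Φ hp hpn h hu hΨ (hδ j)
  simp only [one_mul] at hreg
  have hle : alpha n p ^ (p - 1) * ∫ x, |u x| ^ p * (((n : ℝ) - p) *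
      ((1 - height Φ x ^ 2) * regWeight p (1 / ((j : ℝ) + 1)) (height Φ x))) ∂(surfaceMeasure n)
      ≤ alpha n p ^ p / 2 * (∫ x, |u x| ^ p * regWeight p (1 / ((j : ℝ) + 1)) (height Φ x)
          ∂(surfaceMeasure n)) + K * N := by
    rw [← integral_const_mul, ← integral_const_mul, ← integral_const_mul,
      ← integral_add ((hint j).const_mul _) (hu.const_mul _)]
    refine integral_mono ?_ (((hint j).const_mul _).add (hu.const_mul _)) fun x => ?_
    · have h1 : ContinuousOn (fun s : ℝ => ((n : ℝ) - p) *
          ((1 - s ^ 2) * regWeight p (1 / ((j : ℝ) + 1)) s)) (Icc (-1) 1) :=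
        continuousOn_const.mul (ContinuousOn.mul (by fun_prop) (continuousOn_regWeight (hδ j)))
      exact (integrable_mul_continuous_sphere hu (continuous_comp_height h1 Φ)).const_mul _
    · have hs := height_mem_Icc Φ x
      have hw := regWeight_pos (p := p) (hδ j) hs
      have hs0 := one_sub_sq_nonneg hs
      set w := regWeight p (1 / ((j : ℝ) + 1)) (height Φ x) with hwdef
      have key : b * ((1 - height Φ x ^ 2) * w) ≤ alpha n p ^ p / 2 * w + K := by
        rcases le_total (1 - height Φ x ^ 2) η with hle | hle
        · have h1 : b * ((1 - height Φ x ^ 2) * w) ≤ b * (η * w) := by gcongr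
          have h2 : 0 ≤ K := by positivity
          calc _ ≤ b * (η * w) := h1
            _ = alpha n p ^ p / 2 * w := by rw [← hηeq]; ring
            _ ≤ _ := by linarith
        · have h1 : w ≤ η ^ (-(p / 2)) :=
            Real.rpow_le_rpow_of_nonpos hη (by linarith [hδ j]) (by linarith)
          have h2 : (1 - height Φ x ^ 2) * w ≤ 1 * η ^ (-(p / 2)) :=
            mul_le_mul (by linarith [sq_nonneg (height Φ x)]) h1 hw.le zero_le_one
          have h3 := mul_le_mul_of_nonneg_left h2 hb0.le
          have h4 : 0 ≤ alpha n p ^ p / 2 * w := by positivity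
          rw [one_mul] at h3
          linarith
      have := mul_le_mul_of_nonneg_left key (Real.rpow_nonneg (abs_nonneg (u x)) p)
      simp only
      calc _ = |u x| ^ p * (b * ((1 - height Φ x ^ 2) * w)) := by rw [hb]; ring
        _ ≤ _ := this
        _ = _ := by ring
  rw [le_div_iff₀ (by positivity)]
  linarith

theorem sine_hardy (hn : 2 ≤ n) (Φ : Sphere n) (hp : 1 < p) (hpn : p < (n : ℝ) - 1)
    (h : IsWeakGradient u Ψ) (hu : Integrable (fun x => |u x| ^ p) (surfaceMeasure n))
    (hΨ : Integrable (fun x => ‖Ψ x‖ ^ p) (surfaceMeasure n)) :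
    alpha n p ^ p * ∫ x, |u x| ^ p * (1 * regWeight p 0 (height Φ x)) ∂(surfaceMeasure n)
      ≤ (∫ x, ‖Ψ x‖ ^ p * |height Φ x| ^ p ∂(surfaceMeasure n))
        + alpha n p ^ (p - 1) * ∫ x, |u x| ^ p * ((((n : ℝ) - p) *
          (1 - height Φ x ^ 2)) * regWeight p 0 (height Φ x)) ∂(surfaceMeasure n) := by
  have hw := integrable_regWeight_zero hn Φ hp hpn h hu hΨ
  have hp0 : 0 < p := by linarith
  have hu0 : ∀ x, 0 ≤ |u x| ^ p := fun x => Real.rpow_nonneg (abs_nonneg _) _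
  have h1 := tendsto_integral_regWeight hn Φ hp0 hu hu0 hw (f := fun _ => 1) continuousOn_const
  have h2 := tendsto_integral_regWeight hn Φ hp0 hu hu0 hw
    (f := fun s => ((n : ℝ) - p) * (1 - s ^ 2)) (by fun_prop)
  refine le_of_tendsto_of_tendsto' (h1.const_mul _) ((h2.const_mul _).const_add _) fun j => ?_
  have := sine_hardy_regularized hn Φ hp hpn h hu hΨ
    (show (0 : ℝ) < 1 / ((j : ℝ) + 1) by positivity)
  simpa only [mul_assoc] using this

theorem abs_rpow_sub_two_mul_sq {p : ℝ} (hp : 1 < p) (s : ℝ) :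
    s * (|s| ^ (p - 2) * s) = |s| ^ p := by
  rcases eq_or_ne s 0 with rfl | hs
  · rw [abs_zero, Real.zero_rpow (by linarith : p ≠ 0), zero_mul]
  · have h1 := Real.rpow_sub_natCast (abs_pos.2 hs).ne' p 2
    push_cast at h1
    rw [h1, sq_abs]
    field_simp

/-- At the origin the difference quotient is |t|^(p-2), continuous exactly because p ≥ 2. -/
theorem hasDerivAt_abs_rpow_mul {p : ℝ} (hp : 2 ≤ p) (s : ℝ) :
    HasDerivAt (fun s : ℝ => |s| ^ (p - 2) * s) ((p - 1) * |s| ^ (p - 2)) s := by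
  rcases eq_or_ne s 0 with rfl | hs
  · have hval : (p - 1) * |(0 : ℝ)| ^ (p - 2) = |(0 : ℝ)| ^ (p - 2) := by
      -- For p = 2 both sides equal 1 because 0 ^ 0 = 1; for p > 2 both vanish.
      rcases eq_or_lt_of_le hp with rfl | hp2
      · norm_num
      · rw [abs_zero, Real.zero_rpow (by linarith), mul_zero]
    rw [hval, hasDerivAt_iff_tendsto_slope]
    have hc : Continuous fun t : ℝ => |t| ^ (p - 2) :=
      continuous_abs.rpow_const fun _ => Or.inr (by linarith)
    refine ((hc.tendsto 0).mono_left nhdsWithin_le_nhds).congr' ?_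
    filter_upwards [self_mem_nhdsWithin] with t ht
    have ht0 : t ≠ 0 := ht
    rw [slope_def_field]
    field_simp
    ring
  · have h1 := ((hasDerivAt_abs hs).rpow_const (p := p - 2) (Or.inl (abs_pos.2 hs).ne')).mul
      (hasDerivAt_id s)
    convert! h1 using 1
    have h2 : (SignType.sign s : ℝ) * s = |s| := sign_mul_self s
    have h3 := Real.rpow_sub_one (abs_pos.2 hs).ne' (p - 2)
    have h4 : |s| ≠ 0 := (abs_pos.2 hs).ne'
    simp only [id]
    calc (p - 1) * |s| ^ (p - 2) = (p - 2) * (|s| ^ (p - 2) / |s|) * |s| + |s| ^ (p - 2) * 1 := by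
          field_simp; ring
      _ = _ := by rw [← h3, ← h2]; ring_nf

/-- The profile k = |s|^(p-2) s satisfies s k = |s|^p, so with A = |s| the main terms match exactly
and the lower-order coefficient L is k'. The singular integrability comes from the sine case. -/
theorem tangent_hardy (hn : 2 ≤ n) (Φ : Sphere n) (hp : 2 ≤ p) (hpn : p < (n : ℝ) - 1)
    (h : IsWeakGradient u Ψ) (hu : Integrable (fun x => |u x| ^ p) (surfaceMeasure n))
    (hΨ : Integrable (fun x => ‖Ψ x‖ ^ p) (surfaceMeasure n)) :
    alpha n p ^ p * ∫ x, |u x| ^ p * (|height Φ x| ^ p * regWeight p 0 (height Φ x))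
        ∂(surfaceMeasure n)
      ≤ (∫ x, ‖Ψ x‖ ^ p ∂(surfaceMeasure n))
        + alpha n p ^ (p - 1) * ∫ x, |u x| ^ p * (((p - 1) * |height Φ x| ^ (p - 2) *
          (1 - height Φ x ^ 2)) * regWeight p 0 (height Φ x)) ∂(surfaceMeasure n) := by
  have hp1 : 1 < p := by linarith
  have hp0 : 0 < p := by linarith
  have hw := integrable_regWeight_zero hn Φ hp1 hpn h hu hΨ
  have hu0 : ∀ x, 0 ≤ |u x| ^ p := fun x => Real.rpow_nonneg (abs_nonneg _) _
  have hc : Continuous fun s : ℝ => |s| ^ p :=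
    continuous_abs.rpow_const fun _ => Or.inr hp0.le
  have hc2 : Continuous fun s : ℝ => (p - 1) * |s| ^ (p - 2) :=
    continuous_const.mul (continuous_abs.rpow_const fun _ => Or.inr (by linarith))
  have h1 := tendsto_integral_regWeight hn Φ hp0 hu hu0 hw hc.continuousOn
  have h2 := tendsto_integral_regWeight hn Φ hp0 hu hu0 hw
    (f := fun s => (p - 1) * |s| ^ (p - 2) * (1 - s ^ 2)) (by
      exact (hc2.mul (by fun_prop)).continuousOn)
  refine le_of_tendsto_of_tendsto' (h1.const_mul _) ((h2.const_mul _).const_add _) fun j => ?_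
  have := hardy_regularized hn Φ hp1 hpn h hu hΨ (k := fun s => |s| ^ (p - 2) * s)
    (k' := fun s => (p - 1) * |s| ^ (p - 2))
    (A := fun s => |s|) (B := fun _ => 1) (L := fun s => (p - 1) * |s| ^ (p - 2))
    (fun s _ => hasDerivAt_abs_rpow_mul hp s) hc2.continuousOn continuous_abs continuous_const
    hc2 (fun s => abs_nonneg s) (fun _ => zero_le_one)
    (fun s _ => by
      have h3 := abs_deriv_abs_rpow hp1 s
      rw [mul_assoc, abs_mul, abs_of_pos hp0] at h3
      rw [mul_one]
      exact (mul_left_cancel₀ hp0.ne' h3).le)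
    (fun s _ => by rw [abs_rpow_sub_two_mul_sq hp1]; positivity)
    (fun s _ => by rw [abs_rpow_sub_two_mul_sq hp1])
    (show (0 : ℝ) < 1 / ((j : ℝ) + 1) by positivity)
  simpa only [mul_assoc, Real.one_rpow, mul_one] using this

end SineHardy

/-! ### Back to sine, cosine and tangent of the geodesic distance. -/

section Translation

variable {p : ℝ}

theorem sin_geoDist (x Φ : Sphere n) : Real.sin (geoDist x Φ) = √(1 - height Φ x ^ 2) :=
  Real.sin_arccos _

theorem cos_geoDist (x Φ : Sphere n) : Real.cos (geoDist x Φ) = height Φ x :=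
  Real.cos_arccos (height_mem_Icc Φ x).1 (height_mem_Icc Φ x).2

theorem tan_geoDist (x Φ : Sphere n) :
    Real.tan (geoDist x Φ) = √(1 - height Φ x ^ 2) / height Φ x :=
  Real.tan_arccos _

theorem regWeight_zero_eq {s : ℝ} (hs : s ^ 2 < 1) :
    regWeight p 0 s = (√(1 - s ^ 2) ^ p)⁻¹ := by
  have h1 : 0 < 1 - s ^ 2 := by linarith
  rw [regWeight, add_zero, Real.rpow_neg h1.le, Real.sqrt_eq_rpow, ← Real.rpow_mul h1.le]
  congr 2; ring

theorem sq_mul_regWeight_zero_eq {s : ℝ} (hs : s ^ 2 < 1) :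
    (1 - s ^ 2) * regWeight p 0 s = (√(1 - s ^ 2) ^ (p - 2))⁻¹ := by
  have h1 : 0 < 1 - s ^ 2 := by linarith
  have h2 : 0 < √(1 - s ^ 2) := Real.sqrt_pos.2 h1
  have h3 := Real.rpow_sub_natCast h2.ne' p 2
  push_cast at h3
  rw [regWeight_zero_eq hs, h3, Real.sq_sqrt h1.le]
  field_simp

theorem sInt_eq {Φ x : Sphere n} (u : Sphere n → ℝ) (hs : height Φ x ^ 2 < 1) :
    sInt Φ p u x = |u x| ^ p * (1 * regWeight p 0 (height Φ x)) := by
  rw [sInt, sin_geoDist, one_mul, regWeight_zero_eq hs]; rfl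

theorem sTildeInt_eq {Φ x : Sphere n} (u : Sphere n → ℝ) (hs : height Φ x ^ 2 < 1) :
    sTildeInt Φ p u x = |u x| ^ p * ((1 - height Φ x ^ 2) * regWeight p 0 (height Φ x)) := by
  rw [sTildeInt, sin_geoDist, sq_mul_regWeight_zero_eq hs]; rfl

theorem tInt_eq {Φ x : Sphere n} (u : Sphere n → ℝ) (hs : height Φ x ^ 2 < 1)
    (h0 : height Φ x ≠ 0) :
    tInt Φ p u x = |u x| ^ p * (|height Φ x| ^ p * regWeight p 0 (height Φ x)) := by
  have h1 : 0 < |height Φ x| ^ p := Real.rpow_pos_of_pos (abs_pos.2 h0) _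
  rw [tInt, tan_geoDist, regWeight_zero_eq hs, abs_div, abs_of_nonneg (Real.sqrt_nonneg _),
    Real.div_rpow (Real.sqrt_nonneg _) (abs_nonneg _), div_div_eq_mul_div]
  ring

theorem tTildeInt_eq {Φ x : Sphere n} (u : Sphere n → ℝ) (hs : height Φ x ^ 2 < 1)
    (h0 : height Φ x ≠ 0) :
    tTildeInt Φ p u x = |u x| ^ p * ((|height Φ x| ^ (p - 2) * (1 - height Φ x ^ 2))
      * regWeight p 0 (height Φ x)) := by
  have h1 : 0 < |height Φ x| ^ (p - 2) := Real.rpow_pos_of_pos (abs_pos.2 h0) _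
  rw [mul_assoc (|height Φ x| ^ (p - 2)), sq_mul_regWeight_zero_eq hs, tTildeInt, tan_geoDist,
    abs_div, abs_of_nonneg (Real.sqrt_nonneg _),
    Real.div_rpow (Real.sqrt_nonneg _) (abs_nonneg _), div_div_eq_mul_div]
  ring

theorem memLp_div {u g : Sphere n → ℝ} (hp : 0 < p)
    (hu : AEStronglyMeasurable u (surfaceMeasure n)) (hg : Measurable g) (hg0 : ∀ x, 0 ≤ g x)
    (h : Integrable (fun x => |u x| ^ p / g x ^ p) (surfaceMeasure n)) :
    MemLp (fun x => u x / g x) (ENNReal.ofReal p) (surfaceMeasure n) := by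
  refine (integrable_norm_rpow_iff (hu.aemeasurable.div hg.aemeasurable).aestronglyMeasurable
    (ENNReal.ofReal_pos.2 hp).ne' ENNReal.ofReal_ne_top).1 (h.congr
      (Eventually.of_forall fun x => ?_))
  simp only [ENNReal.toReal_ofReal hp.le, Real.norm_eq_abs, Pi.div_apply, abs_div]
  rw [abs_of_nonneg (hg0 x), Real.div_rpow (abs_nonneg _) (hg0 x)]

theorem isWeakGradient_weakGrad {u : Sphere n → ℝ} (h : WeaklyDifferentiable u) :
    IsWeakGradient u (weakGrad u) := by
  rw [weakGrad, dif_pos h]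
  exact h.choose_spec

theorem sine_hardy_of_memW1p (hn2 : 2 ≤ n) (Φ : Sphere n) {u : Sphere n → ℝ} (hu : MemW1p p u)
    (hp : 1 < p) (hpn : p < (n : ℝ) - 1) :
    MemLp (fun x => u x / Real.sin (geoDist x Φ)) (ENNReal.ofReal p) (surfaceMeasure n) ∧
    Integrable (sInt Φ p u) (surfaceMeasure n) ∧
    Integrable (gInt Φ p u) (surfaceMeasure n) ∧
    Integrable (sTildeInt Φ p u) (surfaceMeasure n) ∧
    alpha n p ^ p * ∫ x, sInt Φ p u x ∂(surfaceMeasure n) ≤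
      (∫ x, gInt Φ p u x ∂(surfaceMeasure n)) +
        ((n : ℝ) - p) * alpha n p ^ (p - 1) * ∫ x, sTildeInt Φ p u x ∂(surfaceMeasure n) := by
  have hweak := isWeakGradient_weakGrad hu.weaklyDifferentiable
  have hh : Measurable (height Φ) := (continuous_height Φ).measurable
  have hlt := ae_height_sq_lt_one hn2 Φ
  have hp0 : 0 < p := by linarith
  have hui : Integrable (fun x => |u x| ^ p) (surfaceMeasure n) :=
    MemLp.integrable_rpow hp0 hu.memLp
  have hgi := MemLp.integrable_rpow hp0 hu.memLp_grad
  have hw := integrable_regWeight_zero hn2 Φ hp hpn hweak hui hgi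
  have hg : ∀ x, gInt Φ p u x = ‖weakGrad u x‖ ^ p * |height Φ x| ^ p := fun x => by
    rw [gInt, cos_geoDist]
  have hs := hlt.mono fun x hx => (sInt_eq (p := p) u hx)
  have hst := hlt.mono fun x hx => (sTildeInt_eq (p := p) u hx)
  have is : Integrable (sInt Φ p u) (surfaceMeasure n) :=
    (integrable_mul_regWeight_zero Φ hw (f := fun _ => 1) continuousOn_const).congr
      (hs.mono fun x hx => hx.symm)
  refine ⟨?_, is, ?_, ?_, ?_⟩
  · refine memLp_div hp0 hu.memLp.1 ?_ (fun x => ?_) is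
    · simp only [sin_geoDist]
      fun_prop
    · rw [sin_geoDist]; exact Real.sqrt_nonneg _
  · refine (integrable_mul_continuous_sphere hgi (continuous_comp_height
      (f := fun s => |s| ^ p) ?_ Φ)).congr (Eventually.of_forall fun x => (hg x).symm)
    exact (continuous_abs.rpow_const fun _ => Or.inr hp0.le).continuousOn
  · exact (integrable_mul_regWeight_zero Φ hw (f := fun s => 1 - s ^ 2)
      (by fun_prop)).congr (hst.mono fun x hx => hx.symm)
  · have key := sine_hardy hn2 Φ hp hpn hweak hui hgi
    rw [integral_congr_ae hs, integral_congr_ae hst]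
    simp only [hg]
    refine key.trans_eq ?_
    rw [mul_comm ((n : ℝ) - p), mul_assoc (alpha n p ^ (p - 1)),
      ← integral_const_mul ((n : ℝ) - p)]
    refine congrArg _ (congrArg _ (integral_congr_ae (Eventually.of_forall fun x => ?_)))
    simp only
    ring

theorem tangent_hardy_of_memW1p (hn2 : 2 ≤ n) (Φ : Sphere n) {u : Sphere n → ℝ}
    (hu : MemW1p p u) (hp : 2 ≤ p) (hpn : p < (n : ℝ) - 1) :
    MemLp (fun x => u x / |Real.tan (geoDist x Φ)|) (ENNReal.ofReal p) (surfaceMeasure n) ∧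
    Integrable (tInt Φ p u) (surfaceMeasure n) ∧
    Integrable (fInt p u) (surfaceMeasure n) ∧
    Integrable (tTildeInt Φ p u) (surfaceMeasure n) ∧
    alpha n p ^ p * ∫ x, tInt Φ p u x ∂(surfaceMeasure n) ≤
      (∫ x, fInt p u x ∂(surfaceMeasure n)) +
        (p - 1) * alpha n p ^ (p - 1) * ∫ x, tTildeInt Φ p u x ∂(surfaceMeasure n) := by
  have hweak := isWeakGradient_weakGrad hu.weaklyDifferentiable
  have hh : Measurable (height Φ) := (continuous_height Φ).measurable
  have hlt := ae_height_sq_lt_one hn2 Φ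
  have hne := ae_height_ne_zero Φ
  have hp1 : 1 < p := by linarith
  have hp0 : 0 < p := by linarith
  have hui : Integrable (fun x => |u x| ^ p) (surfaceMeasure n) :=
    MemLp.integrable_rpow hp0 hu.memLp
  have hgi := MemLp.integrable_rpow hp0 hu.memLp_grad
  have hw := integrable_regWeight_zero hn2 Φ hp1 hpn hweak hui hgi
  have ht : ∀ᵐ x ∂(surfaceMeasure n), tInt Φ p u x
      = |u x| ^ p * (|height Φ x| ^ p * regWeight p 0 (height Φ x)) :=
    (hlt.and hne).mono fun x hx => tInt_eq u hx.1 hx.2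
  have htt : ∀ᵐ x ∂(surfaceMeasure n), tTildeInt Φ p u x = |u x| ^ p *
      ((|height Φ x| ^ (p - 2) * (1 - height Φ x ^ 2)) * regWeight p 0 (height Φ x)) :=
    (hlt.and hne).mono fun x hx => tTildeInt_eq u hx.1 hx.2
  have it : Integrable (tInt Φ p u) (surfaceMeasure n) :=
    (integrable_mul_regWeight_zero Φ hw (f := fun s => |s| ^ p)
      (continuous_abs.rpow_const fun _ => Or.inr hp0.le).continuousOn).congr
      (ht.mono fun x hx => hx.symm)
  refine ⟨?_, it, hgi, ?_, ?_⟩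
  · refine memLp_div hp0 hu.memLp.1 ?_ (fun x => abs_nonneg _) it
    simp only [tan_geoDist]
    fun_prop
  · refine (integrable_mul_regWeight_zero Φ hw
      (f := fun s => |s| ^ (p - 2) * (1 - s ^ 2)) ?_).congr (htt.mono fun x hx => hx.symm)
    exact ((continuous_abs.rpow_const fun _ => Or.inr (by linarith)).mul
      (by fun_prop)).continuousOn
  · have key := tangent_hardy hn2 Φ hp hpn hweak hui hgi
    rw [integral_congr_ae ht, integral_congr_ae htt]
    refine key.trans_eq ?_
    rw [mul_comm (p - 1), mul_assoc (alpha n p ^ (p - 1)),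
      ← integral_const_mul (p - 1)]
    refine congrArg _ (congrArg _ (integral_congr_ae (Eventually.of_forall fun x => ?_)))
    simp only
    ring

end Translation

end SphereHardy

end

theorem mainTheorem2 (n : ℕ) (hn : 4 ≤ n) (Φ : SphereHardy.Sphere n) (p : ℝ)
    (u : SphereHardy.Sphere n → ℝ) (hu : SphereHardy.MemW1p p u) :
    (1 < p → p < (n : ℝ) - 1 →
      MemLp (fun x => u x / Real.sin (SphereHardy.geoDist x Φ)) (ENNReal.ofReal p)
          (SphereHardy.surfaceMeasure n) ∧
      Integrable (SphereHardy.sInt Φ p u) (SphereHardy.surfaceMeasure n) ∧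
      Integrable (SphereHardy.gInt Φ p u) (SphereHardy.surfaceMeasure n) ∧
      Integrable (SphereHardy.sTildeInt Φ p u) (SphereHardy.surfaceMeasure n) ∧
      SphereHardy.alpha n p ^ p *
          ∫ x, SphereHardy.sInt Φ p u x ∂(SphereHardy.surfaceMeasure n) ≤
        (∫ x, SphereHardy.gInt Φ p u x ∂(SphereHardy.surfaceMeasure n)) +
          ((n : ℝ) - p) * SphereHardy.alpha n p ^ (p - 1) *
            ∫ x, SphereHardy.sTildeInt Φ p u x ∂(SphereHardy.surfaceMeasure n)) ∧
    (2 ≤ p → p < (n : ℝ) - 1 →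
      MemLp (fun x => u x / |Real.tan (SphereHardy.geoDist x Φ)|) (ENNReal.ofReal p)
          (SphereHardy.surfaceMeasure n) ∧
      Integrable (SphereHardy.tInt Φ p u) (SphereHardy.surfaceMeasure n) ∧
      Integrable (SphereHardy.fInt p u) (SphereHardy.surfaceMeasure n) ∧
      Integrable (SphereHardy.tTildeInt Φ p u) (SphereHardy.surfaceMeasure n) ∧
      SphereHardy.alpha n p ^ p *
          ∫ x, SphereHardy.tInt Φ p u x ∂(SphereHardy.surfaceMeasure n) ≤
        (∫ x, SphereHardy.fInt p u x ∂(SphereHardy.surfaceMeasure n)) +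
          (p - 1) * SphereHardy.alpha n p ^ (p - 1) *
            ∫ x, SphereHardy.tTildeInt Φ p u x ∂(SphereHardy.surfaceMeasure n)) := by
  have hn2 : 2 ≤ n := by omega
  exact ⟨SphereHardy.sine_hardy_of_memW1p hn2 Φ hu, SphereHardy.tangent_hardy_of_memW1p hn2 Φ hu⟩
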